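/- Let $N$ be a square-free positive integer and let $$\Gamma_0(N)^+=\Big\{e^{-1/2}\begin{pmatrix}a&b\\c&d\end{pmatrix}\in \mathrm{SL}(2,\mathbb R):\ ad-bc=e,\ a,b,c,d,e\in\mathbb Z,\ e\ge 1,\ e\mid N,\ e\mid a,\ e\mid d,\ N\mid c\Big\}.$$ Let $\Gamma_\infty(N)$ be the stabilizer of the cusp $i\infty$ in $\Gamma_0(N)^+$ (the elements with lower left entry $0$). For $z=x+iy$ with $y>0$ and $\Re(s)>1$ let $$\mathcal E_\infty(z,s)=\sum_{\gamma\in\Gamma_\infty(N)\backslash\Gamma_0(N)^+}\Im(\gamma z)^s ,$$ which converges absolutely and has a Fourier expansion $$\mathcal E_\infty(z,s)=y^s+\varphi_N(s)y^{1-s}+\sum_{m\neq 0}\varphi_N(m,s)W_s(mz),\qquad W_s(mz)=2\sqrt{|m|y}\,K_{s-1/2}(2\pi|m|y)\,e^{2\pi i m x},$$ for all such $z$, where $K_\nu$ is the modified Bessel function of the second kind and $\varphi_N(s)$, $\varphi_N(m,s)$ do not depend on $z$. For a positive integer $m$ and a prime $p$ let $p^{\alpha_p}$ be the highest power of $p$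 dividing $m$, and put $$F_p(m,s)=\Big(1-\frac1{p^s}\Big)\Big(1+\frac1{p^{s-1}}+\dots+\frac1{p^{\alpha_p(s-1)}}\Big),\qquad D_N(m,s)=\sum_{v\mid N}v^{-s}\prod_{p\mid v}F_p(m,2s)^{-1}\prod_{p\mid (N/v)}\big(1-F_p(m,2s)^{-1}\big),$$ where the products are over primes $p$, and $\sigma_a(m)=\sum_{d\mid m}d^a$. **Theorem.** For every positive integer $m$ and every $s$ with $\Re(s)>1$, the Fourier coefficients are uniquely determined and $$\varphi_N(m,s)=\varphi_N(-m,s)=\pi^s\,\frac{m^{s-1}}{\Gamma(s)}\cdot\frac{\sigma_{1-2s}(m)}{\zeta(2s)}\cdot D_N(m,s).$$ The right-hand side is a meromorphic function of $s\in\mathbb C$, so this equation gives the meromorphic continuation of $\varphi_N(m,s)$ to the whole complex plane. Moreover $D_N(m,s)$ is the finite product of local factors $$D_N(m,s)=\prod_{p\mid N}\Big(1-\Big(1-\frac1{p^s}\Big)F_p(m,2s)^{-1}\Big).$$ -/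

import Mathlib

open scoped MatrixGroups UpperHalfPlane

namespace Moonshine

/-- `γ ∈ SL(2,ℝ)` has the form `e^{-1/2} (a b; c d)` with `a, b, c, d` integers, `ad - bc = e`,
`e ∣ N`, `e ∣ a`, `e ∣ d` and `N ∣ c`. -/
def IsMoonshine (N : ℕ) (γ : SL(2, ℝ)) : Prop :=
  ∃ (e : ℕ) (a b c d : ℤ), a * d - b * c = e ∧ e ∣ N ∧ (e : ℤ) ∣ a ∧ (e : ℤ) ∣ d ∧ (N : ℤ) ∣ c ∧
    (γ : Matrix (Fin 2) (Fin 2) ℝ) = (Real.sqrt e)⁻¹ • !![(a : ℝ), (b : ℝ); (c : ℝ), (d : ℝ)]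

theorem IsMoonshine.one (N : ℕ) : IsMoonshine N 1 := by
  refine ⟨1, 1, 0, 0, 1, by norm_num, one_dvd _, by simp, by simp, by simp, ?_⟩
  ext i j
  fin_cases i <;> fin_cases j <;> simp

theorem pos_of_eq {e : ℕ} {A : Matrix (Fin 2) (Fin 2) ℝ} {γ : SL(2, ℝ)}
    (h : (γ : Matrix (Fin 2) (Fin 2) ℝ) = (Real.sqrt e)⁻¹ • A) : 0 < e := by
  rcases Nat.eq_zero_or_pos e with rfl | h0
  · have := γ.det_coe
    rw [h] at this
    simp at this
  · exact h0

theorem IsMoonshine.mul {N : ℕ} {γ δ : SL(2, ℝ)} (hγ : IsMoonshine N γ) (hδ : IsMoonshine N δ) :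
    IsMoonshine N (γ * δ) := by
  obtain ⟨e, a, b, c, d, hdet, heN, hea, hed, hNc, hγ⟩ := hγ
  obtain ⟨f, a', b', c', d', hdet', hfN, hfa, hfd, hNc', hδ⟩ := hδ
  have he := pos_of_eq hγ
  have hf := pos_of_eq hδ
  have hg : 0 < Nat.gcd e f := Nat.gcd_pos_of_pos_left _ he
  obtain ⟨e₁, he₁⟩ := Nat.gcd_dvd_left e f
  obtain ⟨f₁, hf₁⟩ := Nat.gcd_dvd_right e f
  have hlcm : Nat.lcm e f = Nat.gcd e f * (e₁ * f₁) := by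
    have h := Nat.gcd_mul_lcm e f
    have h2 : e * f = Nat.gcd e f * (Nat.gcd e f * (e₁ * f₁)) := by
      calc e * f = (Nat.gcd e f * e₁) * (Nat.gcd e f * f₁) := congrArg₂ (· * ·) he₁ hf₁
        _ = _ := by ring
    exact Nat.eq_of_mul_eq_mul_left hg (h.trans h2)
  have hlN : Nat.gcd e f * (e₁ * f₁) ∣ N := hlcm ▸ Nat.lcm_dvd heN hfN
  generalize Nat.gcd e f = g at *
  subst he₁ hf₁
  clear hlcm
  obtain ⟨n, rfl⟩ := hlN
  obtain ⟨x, rfl⟩ := hea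
  obtain ⟨w, rfl⟩ := hed
  obtain ⟨y, rfl⟩ := hNc
  obtain ⟨x', rfl⟩ := hfa
  obtain ⟨w', rfl⟩ := hfd
  obtain ⟨y', rfl⟩ := hNc'
  have hg' : (g : ℝ) ≠ 0 := by positivity
  have hgz : (g : ℤ) ≠ 0 := by exact_mod_cast hg.ne'
  push_cast at *
  refine ⟨e₁ * f₁, e₁ * f₁ * (g * x * x' + b * n * y'), e₁ * x * b' + b * f₁ * w',
    g * (e₁ * f₁) * n * (y * f₁ * x' + e₁ * w * y'), e₁ * f₁ * (n * y * b' + g * w * w'),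
    ?_, ⟨g * n, by ring⟩, by push_cast; exact ⟨_, rfl⟩, by push_cast; exact ⟨_, rfl⟩,
    by push_cast; exact ⟨_, rfl⟩, ?_⟩
  · have h := congrArg₂ (· * ·) hdet hdet'
    beta_reduce at h
    apply mul_left_cancel₀ (mul_ne_zero hgz hgz)
    push_cast
    linear_combination h
  · have hs : (Real.sqrt (g * e₁ : ℕ))⁻¹ * (Real.sqrt (g * f₁ : ℕ))⁻¹
        = (Real.sqrt (e₁ * f₁ : ℕ))⁻¹ * (g : ℝ)⁻¹ := by
      rw [← mul_inv, ← mul_inv, ← Real.sqrt_mul (by positivity)]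
      congr 1
      have : ((g * e₁ : ℕ) : ℝ) * ((g * f₁ : ℕ) : ℝ) = ((e₁ * f₁ : ℕ) : ℝ) * (g : ℝ) ^ 2 := by
        push_cast; ring
      rw [this, Real.sqrt_mul (by positivity), Real.sqrt_sq (by positivity)]
    rw [Matrix.SpecialLinearGroup.coe_mul, hγ, hδ, Matrix.smul_mul, Matrix.mul_smul, smul_smul]
    push_cast at hs ⊢
    rw [hs, mul_smul]
    congr 1
    ext i j
    fin_cases i <;> fin_cases j <;> simp <;> field_simp

theorem IsMoonshine.inv {N : ℕ} {γ : SL(2, ℝ)} (hγ : IsMoonshine N γ) : IsMoonshine N γ⁻¹ := by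
  obtain ⟨e, a, b, c, d, hdet, heN, hea, hed, hNc, hγ⟩ := hγ
  refine ⟨e, d, -b, -c, a, by linarith, heN, hed, hea, (dvd_neg).2 hNc, ?_⟩
  rw [Matrix.SpecialLinearGroup.coe_inv, hγ, Matrix.adjugate_fin_two]
  ext i j
  fin_cases i <;> fin_cases j <;> simp

/-- The moonshine group `Γ₀(N)⁺`, as a subgroup of `SL(2,ℝ)`. -/
def Gamma0Plus (N : ℕ) : Subgroup SL(2, ℝ) where
  carrier := {γ | IsMoonshine N γ}
  one_mem' := IsMoonshine.one N
  mul_mem' := IsMoonshine.mul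
  inv_mem' := IsMoonshine.inv

/-- The parabolic subgroup `Γ_∞(N)`: the stabilizer of the cusp `i∞` in `Γ₀(N)⁺`, that is, the
matrices whose lower left entry vanishes. -/
def GammaInf (N : ℕ) : Subgroup (Gamma0Plus N) where
  carrier := {γ | (γ : SL(2, ℝ)) 1 0 = 0}
  one_mem' := by simp
  mul_mem' := by
    intro γ δ hγ hδ
    change (γ : SL(2, ℝ)) 1 0 = 0 at hγ
    change (δ : SL(2, ℝ)) 1 0 = 0 at hδ
    change ((γ * δ : Gamma0Plus N) : SL(2, ℝ)) 1 0 = 0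
    simp [Matrix.mul_apply, Fin.sum_univ_two, hγ, hδ]
  inv_mem' := by
    intro γ hγ
    change (γ : SL(2, ℝ)) 1 0 = 0 at hγ
    change ((γ⁻¹ : Gamma0Plus N) : SL(2, ℝ)) 1 0 = 0
    simp [Matrix.SpecialLinearGroup.coe_inv, Matrix.adjugate_fin_two, hγ]

theorem im_smul_of_mem_GammaInf {N : ℕ} {δ : Gamma0Plus N} (hδ : δ ∈ GammaInf N) (z : ℍ) :
    ((δ : SL(2, ℝ)) • z).im = z.im := by
  have h0 : (δ : SL(2, ℝ)) 1 0 = 0 := hδ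
  obtain ⟨e, a, b, c, d, hdet, -, hea, hed, -, h⟩ := δ.2
  have he := pos_of_eq h
  have hs : (Real.sqrt e) ≠ 0 := by positivity
  rw [h] at h0
  have hc : c = 0 := by simpa [hs] using h0
  subst hc
  have he1 : e = 1 := by
    have h2 : (e : ℤ) * e ∣ e := by
      have := mul_dvd_mul hea hed
      rwa [show a * d = e by linarith] at this
    have h3 : e * e ∣ e * 1 := by simpa using (by exact_mod_cast h2 : e * e ∣ e)
    exact Nat.dvd_one.1 (Nat.dvd_of_mul_dvd_mul_left he h3)
  subst he1
  have had : d * a = 1 := by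
    have : a * d = 1 := by simpa using hdet
    rwa [mul_comm] at this
  rw [UpperHalfPlane.specialLinearGroup_apply]
  rcases Int.eq_one_or_neg_one_of_mul_eq_one had with rfl | rfl
  · obtain rfl : a = 1 := by linarith
    simp [h]
  · obtain rfl : a = -1 := by linarith
    simp [h, Complex.div_im]

/-- `Im (γ z)` as a function of the coset `Γ_∞(N) γ`. -/
noncomputable def cosetIm (N : ℕ) (z : ℍ) :
    Quotient (QuotientGroup.rightRel (GammaInf N)) → ℝ :=
  Quotient.lift (fun γ => ((γ : SL(2, ℝ)) • z).im) (by
    intro γ δ h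
    have h' : δ * γ⁻¹ ∈ GammaInf N := QuotientGroup.rightRel_apply.1 h
    have := im_smul_of_mem_GammaInf h' ((γ : SL(2, ℝ)) • z)
    rw [smul_smul] at this
    simpa using this.symm)

/-- The real analytic Eisenstein series `∑_{γ ∈ Γ_∞(N) \ Γ₀(N)⁺} Im(γ z)^s`
(the sum converges absolutely when `Re s > 1`). -/
noncomputable def eisenstein (N : ℕ) (z : ℍ) (s : ℂ) : ℂ :=
  ∑' q : Quotient (QuotientGroup.rightRel (GammaInf N)), (cosetIm N z q : ℂ) ^ s

/-- The modified Bessel function `K_ν(x)`, for `x > 0` and complex `ν`, through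
`K_ν(x) = (1/2) ∫_0^∞ t^{ν-1} exp(-(x/2)(t + 1/t)) dt`. -/
noncomputable def besselK (ν : ℂ) (x : ℝ) : ℂ :=
  (1 / 2) * ∫ t in Set.Ioi (0 : ℝ), (t : ℂ) ^ (ν - 1) * (Real.exp (-(x / 2) * (t + 1 / t)) : ℂ)

/-- The Whittaker function at `m z`:
`W_s(mz) = 2 √(|m| y) K_{s-1/2}(2π|m|y) e(mx)`, where `z = x + iy` and `e(t) = exp(2πit)`. -/
noncomputable def whittaker (s : ℂ) (m : ℤ) (z : ℍ) : ℂ :=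
  2 * (Real.sqrt (|(m : ℝ)| * z.im) : ℂ) * besselK (s - 1 / 2) (2 * Real.pi * |(m : ℝ)| * z.im) *
    Complex.exp (2 * Real.pi * Complex.I * m * z.re)

/-- For all `z = x + iy` in the upper half plane, the Eisenstein series has the Fourier expansion
`y^s + c₀ y^{1-s} + ∑_{m ≠ 0} c(m) W_s(mz)`. -/
def HasFourierExpansion (N : ℕ) (s c₀ : ℂ) (c : {m : ℤ // m ≠ 0} → ℂ) : Prop :=
  ∀ z : ℍ, HasSum (fun m : {m : ℤ // m ≠ 0} => c m * whittaker s m z)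
    (eisenstein N z s - ((z.im : ℂ) ^ s + c₀ * (z.im : ℂ) ^ (1 - s)))

/-- The divisor function `σ_a(m) = ∑_{d ∣ m} d^a` with complex exponent. -/
noncomputable def sigmaC (a : ℂ) (m : ℕ) : ℂ := ∑ d ∈ m.divisors, (d : ℂ) ^ a

/-- `F_p(m,s) = (1 - p^{-s}) (1 + p^{-(s-1)} + … + p^{-α(s-1)})`, where `p^α` is the highest
power of the prime `p` that divides `m`. -/
noncomputable def localF (p m : ℕ) (s : ℂ) : ℂ :=
  (1 - 1 / (p : ℂ) ^ s) *
    ∑ k ∈ Finset.range (padicValNat p m + 1), 1 / (p : ℂ) ^ ((k : ℂ) * (s - 1))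

/-- `D_N(m,s) = ∑_{v ∣ N} v^{-s} ∏_{p ∣ v} F_p(m,2s)⁻¹ ∏_{p ∣ N/v} (1 - F_p(m,2s)⁻¹)`,
the products being over primes `p`. -/
noncomputable def bigD (N m : ℕ) (s : ℂ) : ℂ :=
  ∑ v ∈ N.divisors, (v : ℂ) ^ (-s) * (∏ p ∈ v.primeFactors, (localF p m (2 * s))⁻¹) *
    ∏ p ∈ (N / v).primeFactors, (1 - (localF p m (2 * s))⁻¹)

/-- The closed form `π^s m^{s-1} / Γ(s) · σ_{1-2s}(m) / ζ(2s) · D_N(m,s)`. -/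
noncomputable def closedForm (N m : ℕ) (s : ℂ) : ℂ :=
  (Real.pi : ℂ) ^ s * ((m : ℂ) ^ (s - 1) / Complex.Gamma s) *
    (sigmaC (1 - 2 * s) m / riemannZeta (2 * s)) * bigD N m s

end Moonshine

namespace Moonshine

/-! ### The factor `D_N` -/

/-! For square-free `N` the cosets correspond to coprime pairs `(c, d)` up to sign: the bottom row
of a representative is `√(N/g) (c, d)` with `g = gcd(c, N)`, so `Im(γz)^s = (g/N)^s y^s
|cz+d|^{-2s}` (`exists_mem_Gamma0Plus`, `pairCoset_injective`, `pairCoset_surjective`,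
`cosetIm_pairCoset_cpow`).

For fixed `c > 0`, Möbius inversion removes the coprimality condition and Poisson summation
(`hasSum_poisson`) expands the remaining sums over `d`. The `m`-th mode of row `c` is then `c^{-2s}`
times the Ramanujan sum of `c` and `m`, times a function `rowMode` that does not depend on `c`
(`hasSum_row_coprime_modes`). Absolute convergence allows summation over `c` first
(`hasSum_eisenstein`), and `cpow_mul_rowMode` identifies the mode with a Whittaker function.

What remains is the Dirichlet series of Ramanujan sums weighted by `(gcd(c, N)/N)^s`
(`tsum_gcd_mul_ramanujanSum`). Unweighted, it is `σ_{1-2s}(m)/ζ(2s)` with Euler factors `F_p =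
F_p(m, 2s)`. The weight `gcd(c, N)^s` replaces `F_p` by `1 + p^s (F_p - 1) = p^s F_p (1 - (1 -
p^{-s})/F_p)` at each `p ∣ N`; these corrections multiply to `N^s D_N(m, s)`.

Uniqueness follows by integrating over a period in `x`, at a height where the Whittaker function in
question does not vanish (`HasFourierExpansion.coeff_unique`). -/

theorem natCast_prod_cpow {ι : Type*} (t : Finset ι) (f : ι → ℕ) (s : ℂ) :
    ((∏ i ∈ t, f i : ℕ) : ℂ) ^ s = ∏ i ∈ t, (f i : ℂ) ^ s := by
  classical
  induction t using Finset.induction_on with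
  | empty => simp
  | insert a t ha ih =>
    rw [Finset.prod_insert ha, Finset.prod_insert ha, Nat.cast_mul,
      Complex.natCast_mul_natCast_cpow, ih]

theorem natCast_cpow_eq_prod_primeFactors {n : ℕ} (hn : Squarefree n) (s : ℂ) :
    (n : ℂ) ^ s = ∏ p ∈ n.primeFactors, (p : ℂ) ^ s := by
  rw [← natCast_prod_cpow, Nat.prod_primeFactors_of_squarefree hn]

/-- The sum over `v ∣ N` is the expansion of `∏ (a_p + b_p)` with `a_p = p^{-s}/F_p` and `b_p = 1 -
1/F_p`. Only the symbol `F_p⁻¹` enters, so the identity needs no condition `F_p ≠ 0`. -/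
theorem bigD_eq_prod {N : ℕ} (hN : Squarefree N) (m : ℕ) (s : ℂ) :
    bigD N m s = ∏ p ∈ N.primeFactors,
      (1 - (1 - 1 / (p : ℂ) ^ s) * (localF p m (2 * s))⁻¹) := by
  have key := ArithmeticFunction.IsMultiplicative.prodPrimeFactors_add_of_squarefree
    (ArithmeticFunction.IsMultiplicative.prodPrimeFactors
      fun p : ℕ => (p : ℂ) ^ (-s) * (localF p m (2 * s))⁻¹)
    (ArithmeticFunction.IsMultiplicative.prodPrimeFactors
      fun p : ℕ => 1 - (localF p m (2 * s))⁻¹) hN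
  rw [ArithmeticFunction.prodPrimeFactors_apply hN.ne_zero, ArithmeticFunction.mul_apply,
    Nat.sum_divisorsAntidiagonal (fun i j =>
      ArithmeticFunction.prodPrimeFactors (fun p : ℕ => (p : ℂ) ^ (-s) * (localF p m (2 * s))⁻¹) i *
      ArithmeticFunction.prodPrimeFactors (fun p : ℕ => 1 - (localF p m (2 * s))⁻¹) j)] at key
  rw [bigD]
  refine Eq.trans (Finset.sum_congr rfl fun v hv => ?_) (key.symm.trans ?_)
  · have hvN := Nat.dvd_of_mem_divisors hv
    have hv0 := (Nat.pos_of_mem_divisors hv).ne'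
    have hw0 : N / v ≠ 0 := (Nat.div_pos (Nat.le_of_dvd (Nat.pos_of_ne_zero hN.ne_zero) hvN)
      (Nat.pos_of_ne_zero hv0)).ne'
    rw [ArithmeticFunction.prodPrimeFactors_apply hv0,
      ArithmeticFunction.prodPrimeFactors_apply hw0,
      Finset.prod_mul_distrib, natCast_cpow_eq_prod_primeFactors (hN.squarefree_of_dvd hvN)]
  · refine Finset.prod_congr rfl fun p hp => ?_
    have hp' := Nat.prime_of_mem_primeFactors hp
    rw [ArithmeticFunction.add_apply, ArithmeticFunction.prodPrimeFactors_apply hp'.ne_zero,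
      ArithmeticFunction.prodPrimeFactors_apply hp'.ne_zero, hp'.primeFactors,
      Finset.prod_singleton, Finset.prod_singleton, Complex.cpow_neg]
    ring

/-! ### Meromorphy of the closed form -/

theorem meromorphicAt_of_differentiable {f : ℂ → ℂ} (hf : Differentiable ℂ f) (z : ℂ) :
    MeromorphicAt f z :=
  (hf.analyticAt z).meromorphicAt

theorem differentiable_natCast_cpow {p : ℕ} (hp : p ≠ 0) {f : ℂ → ℂ} (hf : Differentiable ℂ f) :
    Differentiable ℂ fun s => (p : ℂ) ^ f s :=
  hf.const_cpow (Or.inl (Nat.cast_ne_zero.2 hp))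

theorem meromorphicAt_riemannZeta (z : ℂ) : MeromorphicAt riemannZeta z := by
  rw [show riemannZeta = _ from funext riemannZeta_eq_mul_completedRiemannZeta₀]
  have h1 : MeromorphicAt completedRiemannZeta₀ z :=
    meromorphicAt_of_differentiable differentiable_completedZeta₀ z
  have h2 : MeromorphicAt (fun s : ℂ => (Real.pi : ℂ) ^ (-s / 2)) z := by
    refine meromorphicAt_of_differentiable (Differentiable.const_cpow (by fun_prop) (Or.inl ?_)) z
    exact_mod_cast Real.pi_ne_zero
  -- `Γ` is meromorphic as the inverse of the entire function `1/Γ`; with `0⁻¹ = 0` the double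
  -- inverse is `Γ` at every point.
  have h3 : MeromorphicAt (fun s : ℂ => Complex.Gamma (s / 2 + 1)) z :=
    (meromorphicAt_of_differentiable
      (Complex.differentiable_one_div_Gamma.comp (by fun_prop : Differentiable ℂ
        fun s : ℂ => s / 2 + 1)) z).inv.congr (by simp [Function.comp_def, Filter.EventuallyEq])
  fun_prop

theorem meromorphicAt_localF {p : ℕ} (hp : p ≠ 0) (m : ℕ) (z : ℂ) :
    MeromorphicAt (fun s => localF p m (2 * s)) z := by
  have h (k : ℂ) (a b : ℂ) : MeromorphicAt (fun s => (p : ℂ) ^ (k * (a * s - b))) z :=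
    meromorphicAt_of_differentiable (differentiable_natCast_cpow hp (by fun_prop)) z
  have h' : MeromorphicAt (fun s => (p : ℂ) ^ (2 * s)) z :=
    meromorphicAt_of_differentiable (differentiable_natCast_cpow hp (by fun_prop)) z
  unfold localF
  refine MeromorphicAt.fun_mul (by fun_prop) (MeromorphicAt.fun_sum fun k _ => ?_)
  exact (MeromorphicAt.const 1 z).fun_div (h _ _ _)

theorem meromorphicOn_closedForm {N : ℕ} (hN : Squarefree N) {m : ℕ} (hm : m ≠ 0) :
    MeromorphicOn (closedForm N m) Set.univ := by
  intro z _
  have h1 : MeromorphicAt (fun s : ℂ => (Real.pi : ℂ) ^ s) z :=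
    meromorphicAt_of_differentiable (differentiable_id.const_cpow
      (Or.inl (by exact_mod_cast Real.pi_ne_zero))) z
  have h2 : MeromorphicAt (fun s : ℂ => (m : ℂ) ^ (s - 1)) z :=
    meromorphicAt_of_differentiable (differentiable_natCast_cpow hm (by fun_prop)) z
  have h3 : MeromorphicAt Complex.Gamma z :=
    (meromorphicAt_of_differentiable Complex.differentiable_one_div_Gamma z).inv.congr
      (by simp [Filter.EventuallyEq])
  have h4 : MeromorphicAt (fun s : ℂ => sigmaC (1 - 2 * s) m) z := by
    refine meromorphicAt_of_differentiable (Differentiable.fun_sum fun d hd => ?_) z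
    exact differentiable_natCast_cpow (Nat.pos_of_mem_divisors hd).ne' (by fun_prop)
  have h5 : MeromorphicAt (fun s : ℂ => riemannZeta (2 * s)) z :=
    (meromorphicAt_riemannZeta (2 * z)).comp_analyticAt (g := fun s => 2 * s) (by fun_prop)
  have h6 : MeromorphicAt (fun s : ℂ => bigD N m s) z := by
    simp_rw [bigD_eq_prod hN]
    refine MeromorphicAt.fun_prod fun p hp => ?_
    have hp0 := (Nat.prime_of_mem_primeFactors hp).ne_zero
    have h7 := meromorphicAt_localF hp0 m z
    have h8 : MeromorphicAt (fun s => (p : ℂ) ^ s) z :=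
      meromorphicAt_of_differentiable (differentiable_natCast_cpow hp0 differentiable_id) z
    fun_prop
  unfold closedForm
  fun_prop

/-! ### Ramanujan sums and their Dirichlet series -/

/-- The arithmetic function `n ↦ n` on the divisors of `m`, and `0` elsewhere. -/
def idOnDivisors (m : ℕ) : ArithmeticFunction ℂ where
  toFun n := if n ∣ m then n else 0
  map_zero' := by simp

theorem idOnDivisors_apply (m n : ℕ) : idOnDivisors m n = if n ∣ m then (n : ℂ) else 0 := rfl

/-- The Ramanujan sum `c ↦ ∑_{l ∣ (c, m)} l μ(c / l)`. -/
noncomputable def ramanujanSum (m : ℕ) : ArithmeticFunction ℂ :=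
  idOnDivisors m * (ArithmeticFunction.moebius : ArithmeticFunction ℂ)

theorem isMultiplicative_idOnDivisors (m : ℕ) : (idOnDivisors m).IsMultiplicative := by
  refine ⟨by simp [idOnDivisors_apply], fun {a b} hab => ?_⟩
  have h : a * b ∣ m ↔ a ∣ m ∧ b ∣ m :=
    ⟨fun h => ⟨(dvd_mul_right a b).trans h, (dvd_mul_left b a).trans h⟩,
      fun h => hab.mul_dvd_of_dvd_of_dvd h.1 h.2⟩
  simp only [idOnDivisors_apply, h, ite_and]
  split_ifs <;> simp

theorem isMultiplicative_ramanujanSum (m : ℕ) : (ramanujanSum m).IsMultiplicative :=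
  (isMultiplicative_idOnDivisors m).mul ArithmeticFunction.isMultiplicative_moebius.intCast

theorem sum_divisors_ramanujanSum (m n : ℕ) :
    ∑ d ∈ n.divisors, ramanujanSum m d = idOnDivisors m n := by
  rw [← ArithmeticFunction.coe_mul_zeta_apply, ramanujanSum, mul_assoc,
    ArithmeticFunction.coe_moebius_mul_coe_zeta, mul_one]

/-- Möbius inversion: the divisor sums over `p^(k+1)` and `p^k` differ by one term. -/
theorem ramanujanSum_prime_pow_succ (m : ℕ) {p : ℕ} (hp : p.Prime) (k : ℕ) :
    ramanujanSum m (p ^ (k + 1)) = idOnDivisors m (p ^ (k + 1)) - idOnDivisors m (p ^ k) := by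
  rw [← sum_divisors_ramanujanSum, ← sum_divisors_ramanujanSum, Nat.sum_divisors_prime_pow hp,
    Nat.sum_divisors_prime_pow hp, Finset.sum_range_succ _ (k + 1)]
  ring

/-- The bound is uniform in `m`, as the absolute convergence of the double sum over rows and modes
requires. -/
theorem norm_ramanujanSum_le (m n : ℕ) :
    ‖ramanujanSum m n‖ ≤ ArithmeticFunction.sigma 1 n := by
  rw [ramanujanSum, ArithmeticFunction.mul_apply, ArithmeticFunction.sigma_one_apply,
    Nat.sum_divisorsAntidiagonal (fun i j => idOnDivisors m i *
      (ArithmeticFunction.moebius : ArithmeticFunction ℂ) j), Nat.cast_sum]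
  refine (norm_sum_le _ _).trans (Finset.sum_le_sum fun d _ => ?_)
  rw [norm_mul]
  have h1 : ‖idOnDivisors m d‖ ≤ d := by
    rw [idOnDivisors_apply]
    split_ifs <;> simp
  have h2 : ‖(ArithmeticFunction.moebius : ArithmeticFunction ℂ) (n / d)‖ ≤ 1 := by
    rw [ArithmeticFunction.intCoe_apply, Complex.norm_intCast]
    exact_mod_cast ArithmeticFunction.abs_moebius_le_one
  calc _ ≤ (d : ℝ) * 1 := by gcongr
    _ = d := mul_one _

/-- Since `σ_1` is the convolution of `1` and `n`, its Dirichlet series is a product of two series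
converging for `x > 1` and `x > 2`. It is applied with `x = 2 Re s`. -/
theorem summable_sigma_one_div_rpow {x : ℝ} (hx : 2 < x) :
    Summable fun n : ℕ => (ArithmeticFunction.sigma 1 n : ℝ) / (n : ℝ) ^ x := by
  have h1 : LSeriesSummable (fun n => ((ArithmeticFunction.zeta : ArithmeticFunction ℂ) n)) x := by
    simpa using ArithmeticFunction.LSeriesSummable_zeta_iff.2
      (show 1 < (x : ℂ).re by simp; linarith)
  have h2 : LSeriesSummable
      (fun n => ((ArithmeticFunction.pow 1 : ArithmeticFunction ℕ) : ArithmeticFunction ℂ) n)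
      x := by
    refine LSeriesSummable_of_le_const_mul_rpow (x := 2) (by simpa using hx)
      ⟨1, fun n hn => ?_⟩
    norm_num [ArithmeticFunction.pow_apply]
  have h3 := (ArithmeticFunction.LSeriesSummable_mul h1 h2).norm
  refine h3.congr fun n => ?_
  rcases eq_or_ne n 0 with rfl | hn
  · simp
  · rw [LSeries.term_of_ne_zero hn, norm_div, Complex.norm_natCast_cpow_of_pos
      (Nat.pos_of_ne_zero hn), ← ArithmeticFunction.natCoe_mul,
      ArithmeticFunction.zeta_mul_pow_eq_sigma]
    simp

theorem LSeriesHasSum_idOnDivisors {m : ℕ} (hm : m ≠ 0) (w : ℂ) :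
    LSeriesHasSum (fun n => idOnDivisors m n) w (sigmaC (1 - w) m) := by
  have : HasSum (LSeries.term (fun n => idOnDivisors m n) w)
      (∑ d ∈ m.divisors, LSeries.term (fun n => idOnDivisors m n) w d) := by
    refine hasSum_sum_of_ne_finset_zero fun d hd => ?_
    rcases eq_or_ne d 0 with rfl | h0
    · simp
    · have : ¬ d ∣ m := fun h => hd (Nat.mem_divisors.2 ⟨h, hm⟩)
      simp [LSeries.term_of_ne_zero h0, idOnDivisors_apply, this]
  rw [LSeriesHasSum]
  convert this using 1
  refine Finset.sum_congr rfl fun d hd => ?_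
  have h0 := (Nat.pos_of_mem_divisors hd).ne'
  rw [LSeries.term_of_ne_zero h0, idOnDivisors_apply, if_pos (Nat.dvd_of_mem_divisors hd),
    Complex.cpow_sub _ _ (Nat.cast_ne_zero.2 h0), Complex.cpow_one]

theorem LSeriesHasSum_ramanujanSum {m : ℕ} (hm : m ≠ 0) {w : ℂ} (hw : 1 < w.re) :
    LSeriesHasSum (fun n => ramanujanSum m n) w (sigmaC (1 - w) m / riemannZeta w) := by
  have h1 := ArithmeticFunction.LSeriesHasSum_mul (LSeriesHasSum_idOnDivisors hm w)
    (g := (ArithmeticFunction.moebius : ArithmeticFunction ℂ))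
    (by simpa using (ArithmeticFunction.LSeriesSummable_moebius_iff.2 hw).LSeriesHasSum)
  have h2 := ArithmeticFunction.LSeries_zeta_mul_Lseries_moebius hw
  rw [ArithmeticFunction.LSeries_zeta_eq_riemannZeta hw] at h2
  rw [div_eq_mul_inv, ← eq_inv_of_mul_eq_one_right h2]
  exact h1

/-- With `q = p^{1-w}`, multiplying the geometric sum by `1 - q` gives `1 - q^(α+1)`, which is
nonzero because `|q| < 1`. -/
theorem localF_ne_zero {p : ℕ} (hp : p.Prime) (m : ℕ) {w : ℂ} (hw : 1 < w.re) :
    localF p m w ≠ 0 := by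
  have hp1 : (1 : ℝ) < p := by exact_mod_cast hp.one_lt
  have hlt {x : ℂ} (hx : 0 < x.re) : ‖1 / (p : ℂ) ^ x‖ < 1 := by
    rw [norm_div, norm_one, Complex.norm_natCast_cpow_of_pos hp.pos, div_lt_one (by positivity)]
    exact Real.one_lt_rpow hp1 hx
  have hne {x : ℂ} (hx : ‖x‖ < 1) : 1 - x ≠ 0 := by
    intro h
    rw [← sub_eq_zero.1 h, norm_one] at hx
    exact lt_irrefl _ hx
  have hq := hlt (x := w - 1) (by simpa using hw)
  refine mul_ne_zero (hne (hlt (by linarith))) fun h => ?_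
  have h1 := mul_neg_geom_sum (1 / (p : ℂ) ^ (w - 1)) (padicValNat p m + 1)
  have h2 (k : ℕ) : (1 / (p : ℂ) ^ (w - 1)) ^ k = 1 / (p : ℂ) ^ ((k : ℂ) * (w - 1)) := by
    rw [Complex.cpow_nat_mul, div_pow, one_pow]
  rw [Finset.sum_congr rfl fun k _ => h2 k, h, mul_zero] at h1
  refine hne (x := (1 / (p : ℂ) ^ (w - 1)) ^ (padicValNat p m + 1)) ?_ h1.symm
  rw [norm_pow]
  exact pow_lt_one₀ (norm_nonneg _) hq (Nat.succ_ne_zero _)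

theorem natCast_pow_cpow (p k : ℕ) (w : ℂ) : ((p ^ k : ℕ) : ℂ) ^ w = ((p : ℂ) ^ w) ^ k := by
  have := natCast_prod_cpow (Finset.range k) (fun _ => p) w
  simpa using this

/-- The local factor at `p` of the Dirichlet series of Ramanujan sums. -/
theorem hasSum_ramanujanSum_prime_pow {p : ℕ} (hp : p.Prime) {m : ℕ} (hm : m ≠ 0) (w : ℂ) :
    HasSum (fun k : ℕ => ramanujanSum m (p ^ k) / ((p ^ k : ℕ) : ℂ) ^ w) (localF p m w) := by
  have hpC : (p : ℂ) ≠ 0 := Nat.cast_ne_zero.2 hp.ne_zero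
  set S : ℂ := ∑ k ∈ Finset.range (padicValNat p m + 1), 1 / (p : ℂ) ^ ((k : ℂ) * (w - 1)) with hS
  have ha : HasSum (fun k : ℕ => idOnDivisors m (p ^ k) / ((p ^ k : ℕ) : ℂ) ^ w) S := by
    have : S = ∑ k ∈ Finset.range (padicValNat p m + 1),
        idOnDivisors m (p ^ k) / ((p ^ k : ℕ) : ℂ) ^ w := by
      refine Finset.sum_congr rfl fun k hk => ?_
      have hk' : p ^ k ∣ m := (pow_dvd_pow p (Nat.lt_succ_iff.1 (Finset.mem_range.1 hk))).trans
        pow_padicValNat_dvd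
      rw [idOnDivisors_apply, if_pos hk', mul_sub, mul_one, Complex.cpow_sub _ _ hpC,
        Complex.cpow_natCast, Complex.cpow_nat_mul, natCast_pow_cpow, Nat.cast_pow, one_div_div]
    rw [this]
    refine hasSum_sum_of_ne_finset_zero fun k hk => ?_
    have := Fact.mk hp
    have : ¬ p ^ k ∣ m := fun h => hk (Finset.mem_range.2
      (Nat.lt_succ_iff.2 ((padicValNat_dvd_iff_le hm).1 h)))
    rw [idOnDivisors_apply, if_neg this, zero_div]
  have hb := (ha.mul_left (1 / (p : ℂ) ^ w))
  -- By the difference formula, the `(k+1)`-st term is the `(k+1)`-st term of `ha` minus `p^{-w}`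
  -- times its `k`-th term; the term at `0` is split off.
  rw [← hasSum_nat_add_iff' 1] at ha ⊢
  convert ha.sub hb using 1
  · funext k
    rw [ramanujanSum_prime_pow_succ m hp, sub_div]
    congr 1
    rw [natCast_pow_cpow, natCast_pow_cpow, pow_succ, one_div, div_eq_mul_inv, div_eq_mul_inv,
      mul_inv]
    ring
  · rw [localF, ← hS]
    simp [(isMultiplicative_ramanujanSum m).map_one, (isMultiplicative_idOnDivisors m).map_one]
    ring

theorem summable_norm_ramanujanSum {m : ℕ} (hm : m ≠ 0) {w : ℂ} (hw : 1 < w.re) :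
    Summable fun n : ℕ => ‖ramanujanSum m n / (n : ℂ) ^ w‖ := by
  refine (LSeriesHasSum_ramanujanSum hm hw).summable.norm.congr fun n => ?_
  rcases eq_or_ne n 0 with rfl | hn
  · simp
  · rw [LSeries.term_of_ne_zero hn]

theorem tsum_ramanujanSum {m : ℕ} (hm : m ≠ 0) {w : ℂ} (hw : 1 < w.re) :
    ∑' n : ℕ, ramanujanSum m n / (n : ℂ) ^ w = sigmaC (1 - w) m / riemannZeta w := by
  rw [← (LSeriesHasSum_ramanujanSum hm hw).LSeries_eq, LSeries]
  refine tsum_congr fun n => ?_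
  rcases eq_or_ne n 0 with rfl | hn
  · simp
  · rw [LSeries.term_of_ne_zero hn]

/-- The weight `gcd(n, N)^s` is bounded. -/
theorem norm_gcd_cpow_le {N : ℕ} (hN : N ≠ 0) (n : ℕ) {s : ℂ} (hs : 0 ≤ s.re) :
    ‖((n.gcd N : ℕ) : ℂ) ^ s‖ ≤ (N : ℝ) ^ s.re := by
  have hpos : 0 < n.gcd N := Nat.gcd_pos_of_pos_right _ (Nat.pos_of_ne_zero hN)
  rw [Complex.norm_natCast_cpow_of_pos hpos]
  have : n.gcd N ≤ N := Nat.gcd_le_right _ (Nat.pos_of_ne_zero hN)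
  gcongr

/-- The Dirichlet series of Ramanujan sums twisted by `gcd(·, N)^s`. -/
theorem tsum_gcd_mul_ramanujanSum {N : ℕ} (hN : Squarefree N) {m : ℕ} (hm : m ≠ 0) {s : ℂ}
    (hs : 1 / 2 < s.re) :
    ∑' n : ℕ, ((n.gcd N : ℕ) : ℂ) ^ s * (ramanujanSum m n / (n : ℂ) ^ (2 * s)) =
      (N : ℂ) ^ s * (sigmaC (1 - 2 * s) m / riemannZeta (2 * s) * bigD N m s) := by
  have hw : 1 < (2 * s).re := by simp; linarith
  have hR := isMultiplicative_ramanujanSum m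
  set f : ℕ → ℂ := fun n => ramanujanSum m n / (n : ℂ) ^ (2 * s) with hf
  set g : ℕ → ℂ := fun n => ((n.gcd N : ℕ) : ℂ) ^ s * f n with hg
  have hf1 : f 1 = 1 := by simp [hf, hR.map_one]
  have hfmul {a b : ℕ} (hab : a.Coprime b) : f (a * b) = f a * f b := by
    simp only [hf]
    rw [hR.map_mul_of_coprime hab, Nat.cast_mul, Complex.natCast_mul_natCast_cpow]
    ring
  have hgmul {a b : ℕ} (hab : a.Coprime b) : g (a * b) = g a * g b := by
    simp only [hg]
    rw [hfmul hab, Nat.gcd_comm, Nat.Coprime.gcd_mul N hab, Nat.gcd_comm N a,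
      Nat.gcd_comm N b, Nat.cast_mul, Complex.natCast_mul_natCast_cpow]
    ring
  have hfs : Summable fun n => ‖f n‖ := summable_norm_ramanujanSum hm hw
  have hgs : Summable fun n => ‖g n‖ := by
    refine (hfs.mul_left ((N : ℝ) ^ s.re)).of_nonneg_of_le (fun _ => norm_nonneg _) fun n => ?_
    rw [hg, norm_mul]
    exact mul_le_mul_of_nonneg_right (norm_gcd_cpow_le hN.ne_zero n (by linarith)) (norm_nonneg _)
  have Pf := EulerProduct.eulerProduct_hasProd hf1 hfmul hfs (by simp [hf])
  have Pg := EulerProduct.eulerProduct_hasProd (f := g) (by simp [hg, hf1]) hgmul hgs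
    (by simp [hg, hf])
  rw [tsum_ramanujanSum hm hw] at Pf
  set δ : ℕ → ℂ := fun p => if p ∣ N then
    (p : ℂ) ^ s * (1 - (1 - 1 / (p : ℂ) ^ s) * (localF p m (2 * s))⁻¹) else 1 with hδ
  have hloc (p : Nat.Primes) : ∑' e, g (p ^ e) = (∑' e, f (p ^ e)) * δ p := by
    obtain ⟨p, hp⟩ := p
    have hpC : (p : ℂ) ≠ 0 := Nat.cast_ne_zero.2 hp.ne_zero
    have hF := hasSum_ramanujanSum_prime_pow hp hm (2 * s)
    have hF0 := localF_ne_zero hp m hw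
    change HasSum (fun e => f (p ^ e)) _ at hF
    change ∑' e, g (p ^ e) = (∑' e, f (p ^ e)) * δ p
    rw [hF.tsum_eq]
    by_cases hpN : p ∣ N
    -- As `N` is square-free, `gcd(p^e, N) = p` for every `e ≥ 1`, while it is `1` for `e = 0`. So
    -- the series is `p^s F_p` with its constant term corrected from `p^s` to `1`.
    · have h1 : HasSum (fun e => g (p ^ e))
          ((p : ℂ) ^ s * localF p m (2 * s) + (1 - (p : ℂ) ^ s)) := by
        have h2 := (hF.mul_left ((p : ℂ) ^ s)).add (hasSum_ite_eq (0 : ℕ) (1 - (p : ℂ) ^ s))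
        refine h2.congr_fun fun e => ?_
        rcases eq_or_ne e 0 with rfl | he
        · simp [hg, hf1]
        · have hgcd : (p ^ e).gcd N = p := by
            obtain ⟨k, hk⟩ := hpN
            have hpk : p.Coprime k := by
              rw [hp.coprime_iff_not_dvd]
              rintro ⟨l, rfl⟩
              exact hp.one_lt.ne' (Nat.isUnit_iff.1 (hN p ⟨l, by rw [hk]; ring⟩))
            obtain ⟨e, rfl⟩ := Nat.exists_eq_succ_of_ne_zero he
            rw [hk, pow_succ', Nat.gcd_mul_left, (Nat.Coprime.pow_left e hpk).gcd_eq_one, mul_one]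
          simp [hg, hgcd, he]
      have hps : (p : ℂ) ^ s ≠ 0 := by simp [Complex.cpow_eq_zero_iff, hpC]
      rw [h1.tsum_eq, hδ]
      simp only [if_pos hpN]
      field_simp
      ring
    · have hgcd (e : ℕ) : (p ^ e).gcd N = 1 :=
        Nat.Coprime.pow_left e ((hp.coprime_iff_not_dvd).2 hpN)
      simp [hg, hgcd, hδ, hpN, hF.tsum_eq]
  have Pδ : HasProd (fun p : Nat.Primes => δ p) ((N : ℂ) ^ s * bigD N m s) := by
    have h1 : (N : ℂ) ^ s * bigD N m s =
        ∏ p ∈ N.primeFactors.subtype Nat.Prime, δ p := by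
      rw [natCast_cpow_eq_prod_primeFactors hN, bigD_eq_prod hN, ← Finset.prod_mul_distrib,
        Finset.prod_subtype_of_mem (f := δ) fun p hp => Nat.prime_of_mem_primeFactors hp]
      refine Finset.prod_congr rfl fun p hp => ?_
      simp [hδ, Nat.dvd_of_mem_primeFactors hp]
    rw [h1]
    refine hasProd_prod_of_ne_finset_one fun p hp => ?_
    have : ¬ (p : ℕ) ∣ N := fun h => hp (Finset.mem_subtype.2
      (Nat.mem_primeFactors.2 ⟨p.2, h, hN.ne_zero⟩))
    simp [hδ, this]
  have := (Pf.mul Pδ).unique (Pg.congr_fun fun p => (hloc p).symm)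
  rw [← this]
  ring

/-! ### The Bessel integral -/

/-- The integral `∫_0^∞ u^{ν-1} exp(-u - a/u) du`. -/
noncomputable def besselInt (ν : ℂ) (a : ℝ) : ℂ :=
  ∫ u in Set.Ioi (0 : ℝ), (u : ℂ) ^ (ν - 1) * (Real.exp (-u - a / u) : ℂ)

open MeasureTheory Filter Topology Set

theorem norm_besselInt_integrand {u : ℝ} (hu : 0 < u) (ν : ℂ) (a : ℝ) :
    ‖(u : ℂ) ^ (ν - 1) * (Real.exp (-u - a / u) : ℂ)‖ = u ^ (ν.re - 1) * Real.exp (-u - a / u) := by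
  rw [norm_mul, Complex.norm_cpow_eq_rpow_re_of_pos hu, Complex.norm_real, Real.norm_eq_abs,
    Real.abs_exp, Complex.sub_re, Complex.one_re]

theorem norm_besselInt_integrand_le {u : ℝ} (hu : 0 < u) (ν : ℂ) {a : ℝ} (ha : 0 ≤ a) :
    ‖(u : ℂ) ^ (ν - 1) * (Real.exp (-u - a / u) : ℂ)‖ ≤ Real.exp (-u) * u ^ (ν.re - 1) := by
  rw [norm_besselInt_integrand hu, mul_comm]
  have : 0 ≤ a / u := by positivity
  gcongr
  linarith

/-- The estimate `exp(-a/u) ≤ u/a` trades one power of `u` for a factor `1/a`; along `a = (πny)²`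
this gives summability in `n`. -/
theorem norm_besselInt_integrand_le_div {u : ℝ} (hu : 0 < u) (ν : ℂ) {a : ℝ} (ha : 0 < a) :
    ‖(u : ℂ) ^ (ν - 1) * (Real.exp (-u - a / u) : ℂ)‖ ≤
      a⁻¹ * (Real.exp (-u) * u ^ (ν.re + 1 - 1)) := by
  rw [norm_besselInt_integrand hu]
  have h1 : Real.exp (-(a / u)) ≤ u / a := by
    rw [Real.exp_neg, ← inv_div a u]
    have : 0 < a / u := by positivity
    have := Real.add_one_le_exp (a / u)
    gcongr
    linarith
  calc u ^ (ν.re - 1) * Real.exp (-u - a / u)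
      = u ^ (ν.re - 1) * (Real.exp (-u) * Real.exp (-(a / u))) := by
        rw [← Real.exp_add]; ring_nf
    _ ≤ u ^ (ν.re - 1) * (Real.exp (-u) * (u / a)) := by gcongr
    _ = a⁻¹ * (Real.exp (-u) * (u ^ (ν.re - 1) * u)) := by ring
    _ = _ := by
        rw [← Real.rpow_add_one hu.ne']
        ring_nf

theorem measurable_besselInt_integrand (ν : ℂ) (a : ℝ) :
    Measurable fun u : ℝ => (u : ℂ) ^ (ν - 1) * (Real.exp (-u - a / u) : ℂ) := by
  fun_prop

theorem norm_besselInt_le {ν : ℂ} (hν : 0 < ν.re) {a : ℝ} (ha : 0 < a) :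
    ‖besselInt ν a‖ ≤ a⁻¹ * Real.Gamma (ν.re + 1) := by
  rw [Real.Gamma_eq_integral (by linarith), ← integral_const_mul]
  refine norm_integral_le_of_norm_le ((Real.GammaIntegral_convergent (by linarith)).const_mul _) ?_
  exact (ae_restrict_iff' measurableSet_Ioi).2 (.of_forall fun u hu =>
    norm_besselInt_integrand_le_div hu ν ha)

theorem besselInt_zero {ν : ℂ} (hν : 0 < ν.re) : besselInt ν 0 = Complex.Gamma ν := by
  rw [Complex.Gamma_eq_integral hν, Complex.GammaIntegral, besselInt]
  refine integral_congr_ae (.of_forall fun u => ?_)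
  simp [mul_comm]

/-- The limit is nonzero, so the Bessel integral does not vanish for small `a > 0`; uniqueness of
the coefficients rests on this. -/
theorem tendsto_besselInt {ν : ℂ} (hν : 0 < ν.re) :
    Tendsto (besselInt ν) (𝓝[>] 0) (𝓝 (Complex.Gamma ν)) := by
  rw [← besselInt_zero hν]
  refine tendsto_integral_filter_of_dominated_convergence
    (fun u => Real.exp (-u) * u ^ (ν.re - 1)) ?_ ?_ (Real.GammaIntegral_convergent hν) ?_
  · exact .of_forall fun a => (measurable_besselInt_integrand ν a).aestronglyMeasurable
  · filter_upwards [self_mem_nhdsWithin] with a ha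
    exact (ae_restrict_iff' measurableSet_Ioi).2 (.of_forall fun u hu =>
      norm_besselInt_integrand_le hu ν (le_of_lt ha))
  · refine .of_forall fun u => Tendsto.mono_left ?_ nhdsWithin_le_nhds
    have : Continuous fun a : ℝ => (u : ℂ) ^ (ν - 1) * (Real.exp (-u - a / u) : ℂ) := by fun_prop
    exact this.tendsto 0

/-- Substitution `t = (2/x) u`. -/
theorem besselK_eq_besselInt (ν : ℂ) {x : ℝ} (hx : 0 < x) :
    besselK ν x = 1 / 2 * ((2 / x : ℝ) : ℂ) ^ ν * besselInt ν (x ^ 2 / 4) := by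
  have hb : 0 < 2 / x := by positivity
  have h := integral_comp_mul_left_Ioi
    (fun t : ℝ => (t : ℂ) ^ (ν - 1) * (Real.exp (-(x / 2) * (t + 1 / t)) : ℂ)) 0 hb
  rw [mul_zero] at h
  have h1 : ∫ u in Ioi (0 : ℝ), ((2 / x * u : ℝ) : ℂ) ^ (ν - 1) *
      (Real.exp (-(x / 2) * (2 / x * u + 1 / (2 / x * u))) : ℂ) =
      ((2 / x : ℝ) : ℂ) ^ (ν - 1) * besselInt ν (x ^ 2 / 4) := by
    rw [besselInt, ← integral_const_mul]
    refine setIntegral_congr_fun measurableSet_Ioi fun u hu => ?_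
    have hu : 0 < u := hu
    have h2 : -(x / 2) * (2 / x * u + 1 / (2 / x * u)) = -u - x ^ 2 / 4 / u := by
      field_simp
      ring
    simp only [h2]
    rw [Complex.ofReal_mul, Complex.mul_cpow_ofReal_nonneg hb.le hu.le]
    ring
  rw [h1] at h
  have hbC : ((2 / x : ℝ) : ℂ) ≠ 0 := Complex.ofReal_ne_zero.2 hb.ne'
  have h3 : ∫ t in Ioi (0 : ℝ), (t : ℂ) ^ (ν - 1) * (Real.exp (-(x / 2) * (t + 1 / t)) : ℂ) =
      ((2 / x : ℝ) : ℂ) ^ ν * besselInt ν (x ^ 2 / 4) := by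
    rw [Complex.real_smul, Complex.ofReal_inv, eq_inv_mul_iff_mul_eq₀ hbC, ← mul_assoc] at h
    rw [← h]
    congr 1
    rw [Complex.cpow_sub _ _ hbC, Complex.cpow_one]
    field_simp
  rw [besselK, h3]
  ring

theorem summable_norm_besselInt {ν : ℂ} (hν : 0 < ν.re) {y : ℝ} (hy : 0 < y) :
    Summable fun n : ℤ => ‖besselInt ν ((Real.pi * n * y) ^ 2)‖ := by
  have h := (Real.summable_abs_int_rpow (b := 2) (by norm_num)).mul_left
    (((Real.pi * y) ^ 2)⁻¹ * Real.Gamma (ν.re + 1))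
  refine Summable.of_norm_bounded_eventually h ?_
  have : ∀ᶠ n : ℤ in cofinite, n ≠ 0 := by
    simpa using (finite_singleton (0 : ℤ)).compl_mem_cofinite
  filter_upwards [this] with n hn
  have hn' : 0 < |(n : ℝ)| := abs_pos.2 (Int.cast_ne_zero.2 hn)
  have hsq : (n : ℝ) ^ 2 = |(n : ℝ)| ^ 2 := (sq_abs _).symm
  rw [norm_norm]
  refine (norm_besselInt_le hν (a := (Real.pi * n * y) ^ 2) ?_).trans_eq ?_
  · have : (n : ℝ) ≠ 0 := Int.cast_ne_zero.2 hn
    have := Real.pi_pos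
    positivity
  · rw [Real.rpow_neg hn'.le, show Real.pi * n * y = Real.pi * y * n by ring, mul_pow _ (n : ℝ),
      hsq, mul_inv, ← Real.rpow_natCast |(n : ℝ)| 2]
    push_cast
    ring

/-! ### Poisson summation -/

theorem integral_exp_mul_gaussian {u : ℝ} (hu : 0 < u) (ξ : ℝ) :
    ∫ t : ℝ, Complex.exp (((-2 * Real.pi * t * ξ : ℝ) : ℂ) * Complex.I) *
      (Real.exp (-u * t ^ 2) : ℂ) =
    ((Real.pi / u : ℝ) : ℂ) ^ (1 / 2 : ℂ) * (Real.exp (-((Real.pi * ξ) ^ 2 / u)) : ℂ) := by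
  have h := fourierIntegral_gaussian (b := (u : ℂ)) (by simpa using hu) (-2 * Real.pi * ξ : ℂ)
  push_cast at h ⊢
  convert h using 2
  · funext t
    congr 2
    ring
  · congr 1
    field_simp
    ring

/-- The Fourier transform of `(t² + y²)^{-s}`. -/
theorem fourier_integral_cpow {s : ℂ} (hs : 1 / 2 < s.re) {y : ℝ} (hy : 0 < y) (ξ : ℝ) :
    ∫ t : ℝ, Complex.exp (((-2 * Real.pi * t * ξ : ℝ) : ℂ) * Complex.I) *
      ((t ^ 2 + y ^ 2 : ℝ) : ℂ) ^ (-s) =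
    (Real.sqrt Real.pi : ℂ) / Complex.Gamma s * (y : ℂ) ^ (1 - 2 * s) *
      besselInt (s - 1 / 2) ((Real.pi * ξ * y) ^ 2) := by
  have hΓ : Complex.Gamma s ≠ 0 := Complex.Gamma_ne_zero_of_re_pos (by linarith)
  set e : ℝ → ℂ := fun t => Complex.exp (((-2 * Real.pi * t * ξ : ℝ) : ℂ) * Complex.I) with he
  have henorm (t : ℝ) : ‖e t‖ = 1 := Complex.norm_exp_ofReal_mul_I _
  -- The Gamma integral writes `Γ(s)(t²+y²)^{-s}` as an integral over `u`. After exchanging the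
  -- integrals, the one over `t` is Gaussian.
  set G : ℝ → ℝ → ℂ := fun t u =>
    e t * ((u : ℂ) ^ (s - 1) * (Real.exp (-(t ^ 2 + y ^ 2) * u) : ℂ)) with hG
  have hu_int (t : ℝ) : ∫ u in Ioi (0 : ℝ), G t u =
      Complex.Gamma s * (e t * ((t ^ 2 + y ^ 2 : ℝ) : ℂ) ^ (-s)) := by
    have hpos : 0 < t ^ 2 + y ^ 2 := by positivity
    have h := Complex.integral_cpow_mul_exp_neg_mul_Ioi (a := s) (by linarith) hpos
    rw [hG, integral_const_mul]
    have : ∫ u in Ioi (0 : ℝ), (u : ℂ) ^ (s - 1) * (Real.exp (-(t ^ 2 + y ^ 2) * u) : ℂ) =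
        ((t ^ 2 + y ^ 2 : ℝ) : ℂ) ^ (-s) * Complex.Gamma s := by
      rw [Complex.cpow_neg, ← Complex.inv_cpow, ← one_div, ← h]
      · refine integral_congr_ae (.of_forall fun u => ?_)
        push_cast
        ring_nf
      · rw [Complex.arg_ofReal_of_nonneg hpos.le]
        exact Real.pi_pos.ne
    rw [this]
    ring
  have ht_int {u : ℝ} (hu : 0 < u) : ∫ t : ℝ, G t u = (Real.sqrt Real.pi : ℂ) *
      ((u : ℂ) ^ (s - 1 / 2 - 1) *
        (Real.exp (-(y ^ 2 * u) - (Real.pi * ξ) ^ 2 / u) : ℂ)) := by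
    have h1 : ∀ t, G t u = ((u : ℂ) ^ (s - 1) * (Real.exp (-(y ^ 2 * u)) : ℂ)) *
        (e t * (Real.exp (-u * t ^ 2) : ℂ)) := fun t => by
      simp only [hG]
      rw [show -(t ^ 2 + y ^ 2) * u = -(y ^ 2 * u) + -u * t ^ 2 by ring, Real.exp_add]
      push_cast
      ring
    simp_rw [h1]
    rw [integral_const_mul, integral_exp_mul_gaussian hu, sub_eq_add_neg (-(y ^ 2 * u)),
      Real.exp_add, div_eq_mul_inv Real.pi, Complex.ofReal_mul,
      Complex.mul_cpow_ofReal_nonneg Real.pi_pos.le (by positivity),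
      Real.sqrt_eq_rpow, Complex.ofReal_cpow Real.pi_pos.le, sub_right_comm,
      Complex.cpow_sub _ (1 / 2) (Complex.ofReal_ne_zero.2 hu.ne'), Complex.ofReal_inv,
      Complex.inv_cpow _ _ (by
        rw [Complex.arg_ofReal_of_nonneg hu.le]
        exact Real.pi_pos.ne)]
    push_cast
    ring
  have hint : Integrable (Function.uncurry fun u t => G t u)
      ((volume.restrict (Ioi (0 : ℝ))).prod volume) := by
    have hmeas : Measurable (Function.uncurry fun u t => G t u) := by
      simp only [hG, he, Function.uncurry_def]
      fun_prop
    have hnorm {u : ℝ} (hu : 0 < u) (t : ℝ) :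
        ‖G t u‖ = u ^ (s.re - 1) * Real.exp (-(y ^ 2) * u) * Real.exp (-u * t ^ 2) := by
      simp only [hG]
      rw [norm_mul, henorm, one_mul, norm_mul, Complex.norm_cpow_eq_rpow_re_of_pos hu,
        Complex.norm_real, Real.norm_eq_abs, Real.abs_exp, mul_assoc, ← Real.exp_add]
      simp only [Complex.sub_re, Complex.one_re]
      ring_nf
    refine (integrable_prod_iff hmeas.aestronglyMeasurable).2 ⟨?_, ?_⟩
    · refine (ae_restrict_iff' measurableSet_Ioi).2 (.of_forall fun u hu => ?_)
      refine Integrable.mono'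
        ((integrable_exp_neg_mul_sq hu).const_mul (u ^ (s.re - 1) * Real.exp (-(y ^ 2) * u)))
        (hmeas.comp (measurable_const.prodMk measurable_id)).aestronglyMeasurable
        (.of_forall fun t => (hnorm hu t).le)
    -- The `t`-integral of the norm is `√π u^{Re s - 3/2} exp(-y² u)`, integrable near `0` because
    -- `Re s > 1/2`.
    · have h := (integrableOn_rpow_mul_exp_neg_mul_rpow (p := 1) (s := s.re - 1 / 2 - 1)
        (b := y ^ 2) (by linarith) one_pos (by positivity)).const_mul (Real.sqrt Real.pi)
      refine IntegrableOn.congr_fun h (fun u hu => ?_) measurableSet_Ioi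
      have hu : 0 < u := hu
      simp only [Function.uncurry_apply_pair]
      simp_rw [hnorm hu]
      rw [integral_const_mul, integral_gaussian, Real.sqrt_div Real.pi_pos.le, sub_right_comm,
        Real.rpow_sub hu _ (1 / 2), ← Real.sqrt_eq_rpow, Real.rpow_one]
      ring
  -- Substitution `v = y² u`.
  have hsub : ∫ u in Ioi (0 : ℝ), (u : ℂ) ^ (s - 1 / 2 - 1) *
      (Real.exp (-(y ^ 2 * u) - (Real.pi * ξ) ^ 2 / u) : ℂ) =
      (y : ℂ) ^ (1 - 2 * s) * besselInt (s - 1 / 2) ((Real.pi * ξ * y) ^ 2) := by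
    have hb : 0 < y ^ 2 := by positivity
    have hyC : (y : ℂ) ≠ 0 := Complex.ofReal_ne_zero.2 hy.ne'
    have h := integral_comp_mul_left_Ioi (fun v : ℝ => (v : ℂ) ^ (s - 1 / 2 - 1) *
      (Real.exp (-v - (Real.pi * ξ * y) ^ 2 / v) : ℂ)) 0 hb
    rw [mul_zero] at h
    have h1 : ∀ u ∈ Ioi (0 : ℝ), (u : ℂ) ^ (s - 1 / 2 - 1) *
        (Real.exp (-(y ^ 2 * u) - (Real.pi * ξ) ^ 2 / u) : ℂ) =
        (y : ℂ) ^ (3 - 2 * s) * (((y ^ 2 * u : ℝ) : ℂ) ^ (s - 1 / 2 - 1) *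
          (Real.exp (-(y ^ 2 * u) - (Real.pi * ξ * y) ^ 2 / (y ^ 2 * u)) : ℂ)) := by
      intro u hu
      have hu : 0 < u := hu
      have h2 : (Real.pi * ξ * y) ^ 2 / (y ^ 2 * u) = (Real.pi * ξ) ^ 2 / u := by
        field_simp
      have h3 : (y : ℂ) ^ (3 - 2 * s) * (y : ℂ) ^ (2 * (s - 1 / 2 - 1)) = 1 := by
        rw [← Complex.cpow_add _ _ hyC]
        ring_nf
        exact Complex.cpow_zero _
      have h4 : ((y ^ 2 : ℝ) : ℂ) ^ (s - 1 / 2 - 1) = (y : ℂ) ^ (2 * (s - 1 / 2 - 1)) := by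
        rw [pow_two, Complex.ofReal_mul, Complex.mul_cpow_ofReal_nonneg hy.le hy.le, two_mul,
          Complex.cpow_add _ _ hyC]
      rw [h2, Complex.ofReal_mul, Complex.mul_cpow_ofReal_nonneg hb.le hu.le, h4]
      linear_combination -(u : ℂ) ^ (s - 1 / 2 - 1) *
        (Real.exp (-(y ^ 2 * u) - (Real.pi * ξ) ^ 2 / u) : ℂ) * h3
    rw [setIntegral_congr_fun measurableSet_Ioi h1, integral_const_mul, h, Complex.real_smul,
      besselInt, ← mul_assoc]
    congr 1
    rw [show (3 - 2 * s : ℂ) = (1 - 2 * s) + (2 : ℕ) by push_cast; ring,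
      Complex.cpow_add _ _ hyC, Complex.cpow_natCast]
    push_cast
    field_simp
  have hswap : ∫ t : ℝ, ∫ u in Ioi (0 : ℝ), G t u = ∫ u in Ioi (0 : ℝ), ∫ t : ℝ, G t u :=
    (integral_integral_swap hint).symm
  simp_rw [hu_int] at hswap
  rw [integral_const_mul, setIntegral_congr_fun measurableSet_Ioi fun u hu => ht_int hu,
    integral_const_mul, hsub] at hswap
  rw [div_mul_eq_mul_div, div_mul_eq_mul_div, eq_div_iff hΓ, mul_comm, hswap]
  ring

theorem norm_exp_two_pi_int (n : ℤ) (x : ℝ) :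
    ‖Complex.exp (2 * Real.pi * Complex.I * n * x)‖ = 1 := by
  rw [show (2 * Real.pi * Complex.I * n * x : ℂ) = ((2 * Real.pi * n * x : ℝ) : ℂ) * Complex.I by
    push_cast; ring]
  exact Complex.norm_exp_ofReal_mul_I _

/-- Poisson summation for `(t² + y²)^{-s}`. -/
theorem hasSum_poisson {s : ℂ} (hs : 1 / 2 < s.re) {y : ℝ} (hy : 0 < y) (x : ℝ) :
    HasSum (fun n : ℤ => (Real.sqrt Real.pi : ℂ) / Complex.Gamma s * (y : ℂ) ^ (1 - 2 * s) *
        besselInt (s - 1 / 2) ((Real.pi * n * y) ^ 2) *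
        Complex.exp (2 * Real.pi * Complex.I * n * x))
      (∑' n : ℤ, (((x + n) ^ 2 + y ^ 2 : ℝ) : ℂ) ^ (-s)) := by
  set f : ℝ → ℂ := fun t => ((t ^ 2 + y ^ 2 : ℝ) : ℂ) ^ (-s) with hf
  have hpos (t : ℝ) : 0 < t ^ 2 + y ^ 2 := by positivity
  have hc : Continuous f := by
    refine Continuous.cpow (by fun_prop) continuous_const fun t => ?_
    exact Complex.ofReal_mem_slitPlane.2 (hpos t)
  have hdecay : f =O[cocompact ℝ] fun t : ℝ => |t| ^ (-(2 * s.re)) := by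
    refine Asymptotics.IsBigO.of_bound 1 ?_
    have : ∀ᶠ t : ℝ in cocompact ℝ, t ≠ 0 := by
      simpa using (isCompact_singleton (x := (0 : ℝ))).compl_mem_cocompact
    filter_upwards [this] with t ht
    have ht' : 0 < |t| := abs_pos.2 ht
    rw [hf, Complex.norm_cpow_eq_rpow_re_of_pos (hpos t), one_mul, Real.norm_eq_abs,
      abs_of_nonneg (by positivity), Complex.neg_re, ← mul_neg, Real.rpow_mul ht'.le]
    refine Real.rpow_le_rpow_of_nonpos (by positivity) ?_ (by linarith)
    norm_num
    positivity
  have hF (ξ : ℝ) : FourierTransform.fourier f ξ =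
      (Real.sqrt Real.pi : ℂ) / Complex.Gamma s * (y : ℂ) ^ (1 - 2 * s) *
      besselInt (s - 1 / 2) ((Real.pi * ξ * y) ^ 2) := by
    rw [Real.fourier_real_eq_integral_exp_smul, ← fourier_integral_cpow hs hy]
    rfl
  have hν : 0 < (s - 1 / 2).re := by
    norm_num
    linarith
  have hnorm := (summable_norm_besselInt hν hy).mul_left
    ‖(Real.sqrt Real.pi : ℂ) / Complex.Gamma s * (y : ℂ) ^ (1 - 2 * s)‖
  have hsum : Summable fun n : ℤ => FourierTransform.fourier f (n : ℝ) := by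
    refine Summable.of_norm (hnorm.congr fun n => ?_)
    rw [hF, norm_mul _ (besselInt _ _)]
  have key := Real.tsum_eq_tsum_fourier_of_rpow_decay_of_summable hc (by linarith) hdecay hsum x
  have hterm (n : ℤ) : FourierTransform.fourier f (n : ℝ) * fourier n (x : UnitAddCircle) =
      (Real.sqrt Real.pi : ℂ) / Complex.Gamma s * (y : ℂ) ^ (1 - 2 * s) *
        besselInt (s - 1 / 2) ((Real.pi * n * y) ^ 2) *
        Complex.exp (2 * Real.pi * Complex.I * n * x) := by
    rw [hF, fourier_coe_apply]
    simp
  simp_rw [hterm] at key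
  change HasSum _ (∑' n : ℤ, f (x + n))
  rw [key]
  refine (Summable.of_norm (hnorm.congr fun n => ?_)).hasSum
  rw [norm_mul _ (Complex.exp _), norm_exp_two_pi_int, mul_one, norm_mul _ (besselInt _ _)]

/-! ### The cosets `Γ_∞(N) \ Γ₀(N)⁺` -/

/-- `|c z + d|²`. -/
noncomputable def latticeNormSq (z : ℍ) (p : ℕ × ℤ) : ℝ :=
  (p.1 * z.re + p.2) ^ 2 + (p.1 * z.im) ^ 2

theorem latticeNormSq_nonneg (z : ℍ) (p : ℕ × ℤ) : 0 ≤ latticeNormSq z p := by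
  rw [latticeNormSq]
  positivity

theorem im_specialLinearGroup_smul (γ : SL(2, ℝ)) (z : ℍ) :
    (γ • z).im = z.im / ((γ 1 0 * z.re + γ 1 1) ^ 2 + (γ 1 0 * z.im) ^ 2) := by
  have hdet : γ 0 0 * γ 1 1 - γ 0 1 * γ 1 0 = 1 := by
    rw [← Matrix.det_fin_two, γ.det_coe]
  have h : (γ • z).im = (((γ 0 0 * z + γ 0 1) / (γ 1 0 * z + γ 1 1) : ℂ)).im := by
    rw [UpperHalfPlane.specialLinearGroup_apply]
    simp
  rw [h, Complex.div_im, ← sub_div]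
  congr 1
  · simp
    linear_combination z.im * hdet
  · rw [Complex.normSq_apply]
    simp
    ring

/-- Representatives `(c, d)` of the cosets: coprime pairs up to sign. -/
def coprimePairs : Set (ℕ × ℤ) := {p | IsCoprime (p.1 : ℤ) p.2 ∧ (p.1 = 0 → p.2 = 1)}

/-- Put `e = N / gcd(c, N)`. Square-freeness makes `e` coprime to `c`, hence `c` coprime to `e d`,
and a Bézout relation `u c + v e d = 1` supplies the top row `(e v, -u)` of an integral matrix of
determinant `e` with bottom row `(e c, e d)`. -/
theorem exists_mem_Gamma0Plus {N : ℕ} (hN : Squarefree N) (p : coprimePairs) :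
    ∃ γ : Gamma0Plus N,
      (γ : SL(2, ℝ)) 1 0 = Real.sqrt (N / p.1.1.gcd N : ℕ) * p.1.1 ∧
      (γ : SL(2, ℝ)) 1 1 = Real.sqrt (N / p.1.1.gcd N : ℕ) * p.1.2 := by
  obtain ⟨⟨c, d⟩, hcd, -⟩ := p
  simp only at hcd ⊢
  have hg : 0 < c.gcd N := Nat.gcd_pos_of_pos_right _ (Nat.pos_of_ne_zero hN.ne_zero)
  obtain ⟨e, he⟩ := Nat.gcd_dvd_right c N
  obtain ⟨c', hc'⟩ := Nat.gcd_dvd_left c N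
  set g := c.gcd N with hgdef
  have hdiv : N / g = e := Nat.div_eq_of_eq_mul_right hg he
  rw [hdiv]
  have he0 : 0 < e := Nat.pos_of_ne_zero fun h => hN.ne_zero (by rw [he, h, mul_zero])
  have hce : Nat.Coprime c e := by
    have h1 : Nat.Coprime g e := by
      have := (Nat.squarefree_mul_iff.1 (he ▸ hN)).1
      exact this
    have h2 : Nat.Coprime c' e := by
      have : g * Nat.gcd c' e = g * 1 := by
        rw [← Nat.gcd_mul_left, ← hc', ← he, mul_one]
      exact Nat.eq_of_mul_eq_mul_left hg this
    rw [hc']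
    exact Nat.Coprime.mul_left h1 h2
  have hco : IsCoprime (c : ℤ) (e * d) :=
    IsCoprime.mul_right (Nat.isCoprime_iff_coprime.2 hce) hcd
  obtain ⟨u, v, huv⟩ := hco
  have hs : Real.sqrt e ≠ 0 := by positivity
  have hinv : (Real.sqrt e)⁻¹ * e = Real.sqrt e := by
    rw [inv_mul_eq_iff_eq_mul₀ hs, Real.mul_self_sqrt (by positivity)]
  refine ⟨⟨⟨(Real.sqrt e)⁻¹ • !![((e * v : ℤ) : ℝ), ((-u : ℤ) : ℝ); ((e * c : ℤ) : ℝ),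
    ((e * d : ℤ) : ℝ)], ?_⟩, e, e * v, -u, e * c, e * d, ?_, ⟨g, by rw [he, mul_comm]⟩,
    dvd_mul_right _ _, dvd_mul_right _ _, ⟨c', ?_⟩, rfl⟩, ?_, ?_⟩
  · rw [Matrix.det_smul, Matrix.det_fin_two_of, Fintype.card_fin, inv_pow,
      Real.sq_sqrt (by positivity), inv_mul_eq_iff_eq_mul₀ (by positivity)]
    have : (u * c + v * (e * d) : ℝ) = 1 := by exact_mod_cast huv
    push_cast
    linear_combination (e : ℝ) * this
  · linear_combination (e : ℤ) * huv
  · rw [he, hc']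
    push_cast
    ring
  · simp [← mul_assoc, hinv]
  · simp [← mul_assoc, hinv]

/-- Up to sign, the lower left entry of `δ γ⁻¹` is the cross product of the two bottom rows, so a
coset is a bottom row up to scaling. -/
theorem mk_eq_mk_of_bottom_row {N : ℕ} {γ δ : Gamma0Plus N}
    (h : (γ : SL(2, ℝ)) 1 0 * (δ : SL(2, ℝ)) 1 1 = (γ : SL(2, ℝ)) 1 1 * (δ : SL(2, ℝ)) 1 0) :
    (Quotient.mk _ γ : Quotient (QuotientGroup.rightRel (GammaInf N))) = Quotient.mk _ δ := by
  refine Quotient.sound (QuotientGroup.rightRel_apply.2 ?_)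
  change ((δ * γ⁻¹ : Gamma0Plus N) : SL(2, ℝ)) 1 0 = 0
  simp [Matrix.mul_apply, Fin.sum_univ_two, Matrix.SpecialLinearGroup.coe_inv,
    Matrix.adjugate_fin_two]
  linear_combination -h

theorem bottom_row_of_mk_eq_mk {N : ℕ} {γ δ : Gamma0Plus N}
    (h : (Quotient.mk _ γ : Quotient (QuotientGroup.rightRel (GammaInf N))) = Quotient.mk _ δ) :
    (γ : SL(2, ℝ)) 1 0 * (δ : SL(2, ℝ)) 1 1 = (γ : SL(2, ℝ)) 1 1 * (δ : SL(2, ℝ)) 1 0 := by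
  have h1 : ((δ * γ⁻¹ : Gamma0Plus N) : SL(2, ℝ)) 1 0 = 0 :=
    QuotientGroup.rightRel_apply.1 (Quotient.exact h)
  simp [Matrix.mul_apply, Fin.sum_univ_two, Matrix.SpecialLinearGroup.coe_inv,
    Matrix.adjugate_fin_two] at h1
  linear_combination -h1

/-- The coset attached to a coprime pair. -/
noncomputable def pairCoset {N : ℕ} (hN : Squarefree N) (p : coprimePairs) :
    Quotient (QuotientGroup.rightRel (GammaInf N)) :=
  Quotient.mk _ (exists_mem_Gamma0Plus hN p).choose

theorem sqrt_div_gcd_pos {N : ℕ} (hN : N ≠ 0) (c : ℕ) :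
    0 < Real.sqrt (N / c.gcd N : ℕ) := by
  have h := Nat.pos_of_ne_zero hN
  have : 0 < N / c.gcd N :=
    Nat.div_pos (Nat.gcd_le_right _ h) (Nat.gcd_pos_of_pos_right _ h)
  positivity

theorem coprimePairs_ext {p q : ℕ × ℤ} (hp : p ∈ coprimePairs) (hq : q ∈ coprimePairs)
    (h : (p.1 : ℤ) * q.2 = p.2 * q.1) : p = q := by
  obtain ⟨c, d⟩ := p
  obtain ⟨c', d'⟩ := q
  obtain ⟨hp, hp0⟩ := hp
  obtain ⟨hq, hq0⟩ := hq
  simp only at *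
  have h1 : (c : ℤ) ∣ c' := hp.dvd_of_dvd_mul_left ⟨d', h.symm⟩
  have h2 : (c' : ℤ) ∣ c := hq.dvd_of_dvd_mul_right ⟨d, by rw [h, mul_comm]⟩
  obtain rfl : c = c' := Nat.dvd_antisymm (Int.natCast_dvd_natCast.1 h1)
    (Int.natCast_dvd_natCast.1 h2)
  rcases eq_or_ne c 0 with rfl | hc
  · rw [hp0 rfl, hq0 rfl]
  · have : (c : ℤ) ≠ 0 := Int.natCast_ne_zero.2 hc
    rw [mul_comm] at h
    rw [mul_right_cancel₀ this h]

theorem pairCoset_injective {N : ℕ} (hN : Squarefree N) : Function.Injective (pairCoset hN) := by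
  intro p q h
  obtain ⟨hp0, hp1⟩ := (exists_mem_Gamma0Plus hN p).choose_spec
  obtain ⟨hq0, hq1⟩ := (exists_mem_Gamma0Plus hN q).choose_spec
  have h1 := bottom_row_of_mk_eq_mk h
  rw [hp0, hp1, hq0, hq1] at h1
  refine Subtype.ext (coprimePairs_ext p.2 q.2 ?_)
  have hne := mul_ne_zero (sqrt_div_gcd_pos hN.ne_zero p.1.1).ne'
    (sqrt_div_gcd_pos hN.ne_zero q.1.1).ne'
  have h2 : (p.1.1 * q.1.2 : ℝ) = p.1.2 * q.1.1 := by
    refine mul_left_cancel₀ hne ?_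
    linear_combination h1
  exact_mod_cast h2

theorem exists_coprimePairs_of_isCoprime {c d : ℤ} (h : IsCoprime c d) :
    ∃ p ∈ coprimePairs, c * p.2 = d * p.1 := by
  rcases lt_trichotomy c 0 with hc | rfl | hc
  · obtain ⟨n, hn⟩ := Int.eq_ofNat_of_zero_le (show 0 ≤ -c by linarith)
    refine ⟨(n, -d), ⟨?_, fun h0 => ?_⟩, ?_⟩
    · simp only [← hn]
      exact h.neg_neg
    · simp only at h0
      simp [h0] at hn
      exact absurd hn hc.ne
    · simp [← hn, mul_comm]
  · exact ⟨(0, 1), ⟨isCoprime_one_right, fun _ => rfl⟩, by simp⟩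
  · obtain ⟨n, rfl⟩ := Int.eq_ofNat_of_zero_le hc.le
    refine ⟨(n, d), ⟨h, fun h0 => ?_⟩, mul_comm _ _⟩
    simp only at h0
    simp [h0] at hc

theorem pairCoset_surjective {N : ℕ} (hN : Squarefree N) :
    Function.Surjective (pairCoset hN) := by
  intro q
  obtain ⟨γ, rfl⟩ := Quotient.exists_rep q
  obtain ⟨e, a, b, c, d, hdet, ⟨f, hf⟩, ⟨a', ha'⟩, ⟨d', hd'⟩, ⟨c', hc'⟩, hγ⟩ := γ.2
  have he := pos_of_eq hγ
  have heZ : (e : ℤ) ≠ 0 := by exact_mod_cast he.ne'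
  -- Dividing `ad - bc = e` by `e` leaves `e a' d' - b f c' = 1`.
  have hco : IsCoprime (f * c' : ℤ) d' := by
    refine ⟨-b, e * a', ?_⟩
    refine mul_left_cancel₀ heZ ?_
    rw [ha', hd', hc', hf] at hdet
    push_cast at hdet
    linear_combination hdet
  obtain ⟨p, hp, hpcd⟩ := exists_coprimePairs_of_isCoprime hco
  refine ⟨⟨p, hp⟩, mk_eq_mk_of_bottom_row ?_⟩
  obtain ⟨hp0, hp1⟩ := (exists_mem_Gamma0Plus hN ⟨p, hp⟩).choose_spec
  rw [hp0, hp1, hγ]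
  have hR : (f * c' * p.2 : ℝ) = d' * p.1 := by exact_mod_cast hpcd
  simp [hd', hc', hf]
  linear_combination -(Real.sqrt (e * f / p.1.gcd (e * f) : ℕ) * (Real.sqrt e)⁻¹ * e) * hR

theorem cosetIm_pairCoset {N : ℕ} (hN : Squarefree N) (z : ℍ) (p : coprimePairs) :
    cosetIm N z (pairCoset hN p) = (p.1.1.gcd N / N : ℝ) * (z.im / latticeNormSq z p.1) := by
  obtain ⟨hp0, hp1⟩ := (exists_mem_Gamma0Plus hN p).choose_spec
  change (((exists_mem_Gamma0Plus hN p).choose : SL(2, ℝ)) • z).im = _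
  have hsq : Real.sqrt (N / p.1.1.gcd N : ℕ) ^ 2 = N / p.1.1.gcd N := by
    rw [Real.sq_sqrt (by positivity), Nat.cast_div (Nat.gcd_dvd_right _ _)]
    have := Nat.gcd_pos_of_pos_right p.1.1 (Nat.pos_of_ne_zero hN.ne_zero)
    positivity
  rw [im_specialLinearGroup_smul, hp0, hp1, latticeNormSq]
  set t := Real.sqrt (N / p.1.1.gcd N : ℕ)
  rw [show (t * p.1.1 * z.re + t * p.1.2) ^ 2 + (t * p.1.1 * z.im) ^ 2 =
    t ^ 2 * ((p.1.1 * z.re + p.1.2) ^ 2 + (p.1.1 * z.im) ^ 2) by ring, hsq, ← div_div,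
    div_div_eq_mul_div]
  ring

/-! ### Absolute convergence -/

/-- Comparison with the sum of `‖(c, d)‖^{-2σ}` over `ℤ²`, which converges for `2σ > 2`. -/
theorem summable_latticeNormSq_rpow (z : ℍ) {σ : ℝ} (hσ : 1 < σ) :
    Summable fun p : ℕ × ℤ => latticeNormSq z p ^ (-σ) := by
  have h1 := (EisensteinSeries.summable_one_div_norm_rpow (k := 2 * σ) (by linarith)).mul_left
    (EisensteinSeries.r z ^ (-(2 * σ)))
  have hinj : Function.Injective fun p : ℕ × ℤ => (![(p.1 : ℤ), p.2] : Fin 2 → ℤ) := by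
    intro p q h
    have h0 := congrFun h 0
    have h1 := congrFun h 1
    simp at h0 h1
    exact Prod.ext h0 h1
  refine (h1.comp_injective hinj).of_nonneg_of_le
    (fun p => Real.rpow_nonneg (latticeNormSq_nonneg z p) _) fun p => ?_
  have h2 := EisensteinSeries.summand_bound z (k := 2 * σ) (by linarith) ![(p.1 : ℤ), p.2]
  refine Eq.trans_le ?_ h2
  have h3 : latticeNormSq z p = ‖(p.1 : ℂ) * z + p.2‖ ^ 2 := by
    rw [← Complex.normSq_eq_norm_sq, Complex.normSq_apply, latticeNormSq]
    simp
    ring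
  rw [h3, ← mul_neg, Real.rpow_mul (norm_nonneg _)]
  simp

/-- The summand of the Eisenstein series attached to `(c, d)`. -/
noncomputable def latticeTerm (N : ℕ) (s : ℂ) (z : ℍ) (p : ℕ × ℤ) : ℂ :=
  ((p.1.gcd N : ℕ) : ℂ) ^ s * (N : ℂ) ^ (-s) * ((z.im : ℂ) ^ s * (latticeNormSq z p : ℂ) ^ (-s))

theorem cosetIm_pairCoset_cpow {N : ℕ} (hN : Squarefree N) (s : ℂ) (z : ℍ) (p : coprimePairs) :
    (cosetIm N z (pairCoset hN p) : ℂ) ^ s = latticeTerm N s z p := by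
  have hinv {x : ℝ} (hx : 0 ≤ x) : ((x⁻¹ : ℝ) : ℂ) ^ s = (x : ℂ) ^ (-s) := by
    rw [Complex.ofReal_inv, Complex.inv_cpow, Complex.cpow_neg]
    rw [Complex.arg_ofReal_of_nonneg hx]
    exact Real.pi_pos.ne
  have hq := latticeNormSq_nonneg z p.1
  rw [cosetIm_pairCoset, latticeTerm, div_eq_mul_inv, div_eq_mul_inv, Complex.ofReal_mul,
    Complex.mul_cpow_ofReal_nonneg (by positivity) (mul_nonneg z.im_pos.le (inv_nonneg.2 hq)),
    Complex.ofReal_mul, Complex.ofReal_mul,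
    Complex.mul_cpow_ofReal_nonneg (by positivity) (by positivity),
    Complex.mul_cpow_ofReal_nonneg z.im_pos.le (inv_nonneg.2 hq), hinv hq, hinv (Nat.cast_nonneg N)]
  simp

theorem norm_gcd_cpow_mul_le {N : ℕ} (hN : N ≠ 0) (c : ℕ) {s : ℂ} (hs : 0 ≤ s.re) :
    ‖((c.gcd N : ℕ) : ℂ) ^ s * (N : ℂ) ^ (-s)‖ ≤ 1 := by
  have hpos : (0 : ℝ) < N := Nat.cast_pos.2 (Nat.pos_of_ne_zero hN)
  rw [norm_mul, Complex.norm_natCast_cpow_of_pos (Nat.pos_of_ne_zero hN) (-s), Complex.neg_re]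
  refine (mul_le_mul_of_nonneg_right (norm_gcd_cpow_le hN c hs) (by positivity)).trans_eq ?_
  rw [← Real.rpow_add hpos, add_neg_cancel, Real.rpow_zero]

theorem norm_cpow_neg_of_nonneg {x : ℝ} (hx : 0 ≤ x) {s : ℂ} (hs : s.re ≠ 0) :
    ‖(x : ℂ) ^ (-s)‖ = x ^ (-s.re) := by
  rw [Complex.norm_cpow_eq_rpow_re_of_nonneg hx (by simpa using hs), Complex.neg_re]

theorem summable_norm_latticeTerm {N : ℕ} (hN : N ≠ 0) {s : ℂ} (hs : 1 < s.re) (z : ℍ) :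
    Summable fun p => ‖latticeTerm N s z p‖ := by
  refine ((summable_latticeNormSq_rpow z hs).mul_left ‖(z.im : ℂ) ^ s‖).of_nonneg_of_le
    (fun _ => norm_nonneg _) fun p => ?_
  rw [latticeTerm, norm_mul, norm_mul ((z.im : ℂ) ^ s),
    norm_cpow_neg_of_nonneg (latticeNormSq_nonneg z p) (by linarith)]
  exact mul_le_of_le_one_left (mul_nonneg (norm_nonneg _) (Real.rpow_nonneg
    (latticeNormSq_nonneg z p) _)) (norm_gcd_cpow_mul_le hN p.1 (by linarith))

theorem summable_eisenstein {N : ℕ} (hN : Squarefree N) {s : ℂ} (hs : 1 < s.re) (z : ℍ) :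
    Summable fun q => (cosetIm N z q : ℂ) ^ s := by
  rw [← (Equiv.ofBijective _ ⟨pairCoset_injective hN, pairCoset_surjective hN⟩).summable_iff]
  refine ((summable_norm_latticeTerm hN.ne_zero hs z).of_norm.comp_injective
    (Subtype.val_injective (p := (· ∈ coprimePairs)))).congr fun p => ?_
  exact (cosetIm_pairCoset_cpow hN s z p).symm

theorem eisenstein_eq_tsum {N : ℕ} (hN : Squarefree N) (s : ℂ) (z : ℍ) :
    eisenstein N z s = ∑' p : ℕ × ℤ, coprimePairs.indicator (latticeTerm N s z) p := by
  rw [← tsum_subtype, eisenstein,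
    ← (Equiv.ofBijective _ ⟨pairCoset_injective hN, pairCoset_surjective hN⟩).tsum_eq]
  exact tsum_congr fun p => cosetIm_pairCoset_cpow hN s z p

/-! ### Summation over a row of the lattice -/

/-- The `k` that contribute are the divisors of `gcd(c, d)`, and `μ` sums to zero over them unless
the gcd is `1`. -/
theorem sum_divisors_moebius_dvd {c : ℕ} (hc : c ≠ 0) (d : ℤ) :
    ∑ k ∈ c.divisors, (if (k : ℤ) ∣ d then (ArithmeticFunction.moebius k : ℂ) else 0) =
      if IsCoprime (c : ℤ) d then 1 else 0 := by
  have h1 : c.divisors.filter (fun k : ℕ => (k : ℤ) ∣ d) = (c.gcd d.natAbs).divisors := by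
    ext k
    simp [Nat.dvd_gcd_iff, hc, Int.natCast_dvd]
  have h2 := ArithmeticFunction.coe_mul_zeta_apply (R := ℤ)
    (f := ArithmeticFunction.moebius) (x := c.gcd d.natAbs)
  rw [ArithmeticFunction.moebius_mul_coe_zeta, ArithmeticFunction.one_apply] at h2
  rw [← Finset.sum_filter, h1, ← Int.cast_sum, ← h2]
  have h3 : IsCoprime (c : ℤ) d ↔ c.gcd d.natAbs = 1 := by
    rw [Int.isCoprime_iff_gcd_eq_one, Int.gcd, Int.natAbs_natCast]
  simp [h3]

theorem latticeNormSq_mul (z : ℍ) (l k : ℕ) (d : ℤ) :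
    latticeNormSq z (l * k, k * d) = k * k * latticeNormSq z (l, d) := by
  simp only [latticeNormSq]
  push_cast
  ring

/-- The Epstein-type sum `∑_d |l z + d|^{-2s}` over a row of the lattice. -/
noncomputable def rowSum (s : ℂ) (z : ℍ) (l : ℕ) : ℂ :=
  ∑' d : ℤ, (latticeNormSq z (l, d) : ℂ) ^ (-s)

theorem hasSum_rowSum {s : ℂ} (hs : 1 < s.re) (z : ℍ) (l : ℕ) :
    HasSum (fun d : ℤ => (latticeNormSq z (l, d) : ℂ) ^ (-s)) (rowSum s z l) := by
  refine Summable.hasSum (Summable.of_norm ?_)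
  refine ((summable_latticeNormSq_rpow z hs).prod_factor l).congr fun d => ?_
  rw [norm_cpow_neg_of_nonneg (latticeNormSq_nonneg z _) (by linarith)]

/-- Writing `d = k d'` takes a factor `k²` out of `|l k z + d|²`. -/
theorem hasSum_row_dvd {s : ℂ} (hs : 1 < s.re) (z : ℍ) (l : ℕ) {k : ℕ} (hk : k ≠ 0) :
    HasSum (fun d : ℤ => if (k : ℤ) ∣ d then (latticeNormSq z (l * k, d) : ℂ) ^ (-s) else 0)
      (rowSum s z l / (k : ℂ) ^ (2 * s)) := by
  have hk' : (k : ℤ) ≠ 0 := Int.natCast_ne_zero.2 hk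
  have hkC : (k : ℂ) ≠ 0 := Nat.cast_ne_zero.2 hk
  have hinj : Function.Injective fun d : ℤ => (k : ℤ) * d := mul_right_injective₀ hk'
  rw [← hinj.hasSum_iff]
  · refine ((hasSum_rowSum hs z l).div_const ((k : ℂ) ^ (2 * s))).congr_fun fun d => ?_
    have h := latticeNormSq_mul z l k d
    simp only [Function.comp_apply, dvd_mul_right, if_true, h]
    rw [Complex.ofReal_mul, Complex.mul_cpow_ofReal_nonneg (by positivity)
      (latticeNormSq_nonneg z _), Complex.ofReal_mul, Complex.mul_cpow_ofReal_nonneg (by positivity)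
      (by positivity), two_mul, Complex.cpow_add _ _ hkC, Complex.cpow_neg (k : ℝ)]
    simp only [Complex.ofReal_natCast]
    field_simp
  · intro d hd
    rw [if_neg]
    rintro ⟨d', rfl⟩
    exact hd ⟨d', rfl⟩

theorem hasSum_row_coprime {s : ℂ} (hs : 1 < s.re) (z : ℍ) {c : ℕ} (hc : c ≠ 0) :
    HasSum (fun d : ℤ => if IsCoprime (c : ℤ) d then (latticeNormSq z (c, d) : ℂ) ^ (-s) else 0)
      (∑ x ∈ c.divisorsAntidiagonal,
        (ArithmeticFunction.moebius x.2 : ℂ) * (rowSum s z x.1 / (x.2 : ℂ) ^ (2 * s))) := by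
  have h := hasSum_sum (s := c.divisorsAntidiagonal) (f := fun x (d : ℤ) =>
    (ArithmeticFunction.moebius x.2 : ℂ) *
      if (x.2 : ℤ) ∣ d then (latticeNormSq z (x.1 * x.2, d) : ℂ) ^ (-s) else 0)
    fun x hx => (hasSum_row_dvd hs z x.1 (Nat.ne_zero_of_mem_divisorsAntidiagonal hx).2).mul_left
      (ArithmeticFunction.moebius x.2 : ℂ)
  refine h.congr_fun fun d => ?_
  have h1 : ∀ x ∈ c.divisorsAntidiagonal, (ArithmeticFunction.moebius x.2 : ℂ) *
      (if (x.2 : ℤ) ∣ d then (latticeNormSq z (x.1 * x.2, d) : ℂ) ^ (-s) else 0) =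
      (if (x.2 : ℤ) ∣ d then (ArithmeticFunction.moebius x.2 : ℂ) else 0) *
        (latticeNormSq z (c, d) : ℂ) ^ (-s) := fun x hx => by
    rw [(Nat.mem_divisorsAntidiagonal.1 hx).1]
    split_ifs <;> simp
  rw [Finset.sum_congr rfl h1, ← Finset.sum_mul,
    Nat.sum_divisorsAntidiagonal' (fun _ k =>
      if (k : ℤ) ∣ d then (ArithmeticFunction.moebius k : ℂ) else 0),
    sum_divisors_moebius_dvd hc]
  split_ifs <;> simp

/-- The `m`-th Fourier mode of a row sum. -/
noncomputable def rowMode (s : ℂ) (z : ℍ) (m : ℤ) : ℂ :=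
  (Real.sqrt Real.pi : ℂ) / Complex.Gamma s * (z.im : ℂ) ^ (1 - 2 * s) *
    besselInt (s - 1 / 2) ((Real.pi * m * z.im) ^ 2) *
    Complex.exp (2 * Real.pi * Complex.I * m * z.re)

theorem summable_norm_rowMode {s : ℂ} (hs : 1 / 2 < s.re) (z : ℍ) :
    Summable fun m : ℤ => ‖rowMode s z m‖ :=
  (hasSum_poisson hs z.im_pos z.re).summable.norm

/-- Poisson summation at the point `l z` yields frequencies `n` in `l x`, that is `m = l n` in `x`:
only multiples of `l` occur. The factor `(l y)^{1-2s}` contributes the weight `l / l^{2s}`. -/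
theorem hasSum_rowMode {s : ℂ} (hs : 1 < s.re) (z : ℍ) {l : ℕ} (hl : l ≠ 0) :
    HasSum (fun m : ℤ => rowMode s z m * (idOnDivisors m.natAbs l / (l : ℂ) ^ (2 * s)))
      (rowSum s z l) := by
  have hl' : (l : ℤ) ≠ 0 := Int.natCast_ne_zero.2 hl
  have hl0 : (0 : ℝ) < l := Nat.cast_pos.2 (Nat.pos_of_ne_zero hl)
  have hinj : Function.Injective fun n : ℤ => (l : ℤ) * n := mul_right_injective₀ hl'
  rw [← hinj.hasSum_iff]
  · have h := hasSum_poisson (s := s) (by linarith) (mul_pos hl0 z.im_pos) (l * z.re)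
    refine (h.congr_fun fun n => ?_)
    have h1 : ((l : ℤ) * n).natAbs = l * n.natAbs := by simp [Int.natAbs_mul]
    simp only [Function.comp_apply, rowMode, idOnDivisors_apply, h1, dvd_mul_right, if_true]
    rw [Complex.ofReal_mul, Complex.mul_cpow_ofReal_nonneg hl0.le z.im_pos.le,
      Complex.cpow_sub (x := ((l : ℝ) : ℂ)) _ _ (by simpa using hl), Complex.cpow_one]
    push_cast
    rw [show Real.pi * n * (l * z.im) = Real.pi * (l * n) * z.im by ring,
      show (2 * Real.pi * Complex.I * n * (l * z.re) : ℂ) =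
        2 * Real.pi * Complex.I * (l * n) * z.re by ring]
    ring
  · intro m hm
    have : ¬ l ∣ m.natAbs := fun h => by
      obtain ⟨n, rfl⟩ := Int.natCast_dvd.2 h
      exact hm ⟨n, rfl⟩
    simp [idOnDivisors_apply, this]

/-- Convolving with `μ` turns the weight `l` on divisors of `m` into the Ramanujan sum. -/
theorem hasSum_row_coprime_modes {s : ℂ} (hs : 1 < s.re) (z : ℍ) (c : ℕ) :
    HasSum (fun m : ℤ => rowMode s z m * (ramanujanSum m.natAbs c / (c : ℂ) ^ (2 * s)))
      (∑ x ∈ c.divisorsAntidiagonal,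
        (ArithmeticFunction.moebius x.2 : ℂ) * (rowSum s z x.1 / (x.2 : ℂ) ^ (2 * s))) := by
  have h := hasSum_sum (s := c.divisorsAntidiagonal) fun x hx =>
    ((hasSum_rowMode hs z (Nat.ne_zero_of_mem_divisorsAntidiagonal hx).1).div_const
      ((x.2 : ℂ) ^ (2 * s))).mul_left (ArithmeticFunction.moebius x.2 : ℂ)
  refine h.congr_fun fun m => ?_
  rw [ramanujanSum, ArithmeticFunction.mul_apply, Finset.sum_div, Finset.mul_sum]
  refine Finset.sum_congr rfl fun x hx => ?_
  rw [← (Nat.mem_divisorsAntidiagonal.1 hx).1, Nat.cast_mul, Complex.natCast_mul_natCast_cpow,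
    ArithmeticFunction.intCoe_apply]
  ring

/-! ### The Fourier expansion of the Eisenstein series -/

/-- The contribution `(gcd(c,N)/N)^s c^{-2s} c_c(m)` of the row `c` to the `m`-th Fourier
coefficient, where `c_c(m)` is the Ramanujan sum. -/
noncomputable def coeffTerm (N : ℕ) (s : ℂ) (m : ℤ) (c : ℕ) : ℂ :=
  ((c.gcd N : ℕ) : ℂ) ^ s * (N : ℂ) ^ (-s) * (ramanujanSum m.natAbs c / (c : ℂ) ^ (2 * s))

theorem norm_coeffTerm_le {N : ℕ} (hN : N ≠ 0) {s : ℂ} (hs : 1 < s.re) (m : ℤ) (c : ℕ) :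
    ‖coeffTerm N s m c‖ ≤ (ArithmeticFunction.sigma 1 c : ℝ) / (c : ℝ) ^ (2 * s.re) := by
  rw [coeffTerm, norm_mul]
  refine (mul_le_of_le_one_left (norm_nonneg _)
    (norm_gcd_cpow_mul_le hN c (by linarith))).trans ?_
  rcases eq_or_ne c 0 with rfl | hc
  · simp
  · rw [norm_div, Complex.norm_natCast_cpow_of_pos (Nat.pos_of_ne_zero hc)]
    have := norm_ramanujanSum_le m.natAbs c
    simp only [Complex.mul_re, Complex.re_ofNat, Complex.im_ofNat, zero_mul, sub_zero]
    gcongr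

theorem summable_norm_modes {N : ℕ} (hN : N ≠ 0) {s : ℂ} (hs : 1 < s.re) (z : ℍ) :
    Summable fun p : ℕ × ℤ => ‖coeffTerm N s p.2 p.1 * rowMode s z p.2‖ := by
  have h := (summable_sigma_one_div_rpow (x := 2 * s.re) (by linarith)).mul_of_nonneg
    (summable_norm_rowMode (s := s) (by linarith) z) (fun _ => by positivity)
    (fun _ => norm_nonneg _)
  refine h.of_nonneg_of_le (fun _ => norm_nonneg _) fun p => ?_
  rw [norm_mul]
  exact mul_le_mul_of_nonneg_right (norm_coeffTerm_le hN hs _ _) (norm_nonneg _)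

theorem hasSum_row_zero (N : ℕ) (s : ℂ) (hN : N ≠ 0) (z : ℍ) :
    HasSum (fun d : ℤ => coprimePairs.indicator (latticeTerm N s z) (0, d)) ((z.im : ℂ) ^ s) := by
  have hNC : (N : ℂ) ≠ 0 := Nat.cast_ne_zero.2 hN
  convert hasSum_single (1 : ℤ) ?_ using 1
  · rw [indicator_of_mem (show ((0, 1) : ℕ × ℤ) ∈ coprimePairs from
      ⟨isCoprime_one_right, fun _ => rfl⟩)]
    simp [latticeTerm, latticeNormSq, ← Complex.cpow_add _ _ hNC]
  · intro d hd
    exact indicator_of_notMem (fun h => hd (h.2 rfl)) _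

theorem hasSum_row_succ {N : ℕ} {s : ℂ} (hs : 1 < s.re) (z : ℍ) {c : ℕ} (hc : c ≠ 0) :
    HasSum (fun d : ℤ => coprimePairs.indicator (latticeTerm N s z) (c, d))
      ((z.im : ℂ) ^ s * ∑' m : ℤ, coeffTerm N s m c * rowMode s z m) := by
  have h1 := (hasSum_row_coprime_modes hs z c).mul_left
    (((c.gcd N : ℕ) : ℂ) ^ s * (N : ℂ) ^ (-s))
  have h2 := (hasSum_row_coprime hs z hc).mul_left
    (((c.gcd N : ℕ) : ℂ) ^ s * (N : ℂ) ^ (-s) * (z.im : ℂ) ^ s)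
  have h3 : ∑' m : ℤ, coeffTerm N s m c * rowMode s z m = _ :=
    (h1.congr_fun fun m => by rw [coeffTerm]; ring).tsum_eq
  rw [h3, ← mul_assoc, mul_comm ((z.im : ℂ) ^ s)]
  refine h2.congr_fun fun d => ?_
  by_cases hd : IsCoprime (c : ℤ) d
  · rw [indicator_of_mem (show ((c, d) : ℕ × ℤ) ∈ coprimePairs from ⟨hd, fun h => absurd h hc⟩),
      if_pos hd, latticeTerm]
    ring
  · rw [indicator_of_notMem (show ((c, d) : ℕ × ℤ) ∉ coprimePairs from fun h => hd h.1),
      if_neg hd, mul_zero]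

theorem hasSum_eisenstein {N : ℕ} (hN : Squarefree N) {s : ℂ} (hs : 1 < s.re) (z : ℍ) :
    HasSum (fun m : ℤ => (z.im : ℂ) ^ s * ((∑' c, coeffTerm N s m c) * rowMode s z m))
      (eisenstein N z s - (z.im : ℂ) ^ s) := by
  have hE : HasSum (coprimePairs.indicator (latticeTerm N s z)) (eisenstein N z s) := by
    rw [eisenstein_eq_tsum hN]
    exact ((summable_norm_latticeTerm hN.ne_zero hs z).of_norm.indicator _).hasSum
  -- Row `0` contributes only `y^s`, from the pair `(0, 1)`. Since `coeffTerm` vanishes at `c = 0`,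
  -- one formula covers all rows.
  have hrow := hE.prod_fiberwise (g := fun c => (if c = 0 then (z.im : ℂ) ^ s else 0) +
      (z.im : ℂ) ^ s * ∑' m : ℤ, coeffTerm N s m c * rowMode s z m) fun c => by
    rcases eq_or_ne c 0 with rfl | hc
    · simpa [coeffTerm] using hasSum_row_zero N s hN.ne_zero z
    · simpa [hc] using hasSum_row_succ hs z hc
  have hrow' := hrow.sub (hasSum_ite_eq 0 ((z.im : ℂ) ^ s))
  simp only [add_sub_cancel_left] at hrow'
  have hsum := (summable_norm_modes hN.ne_zero hs z).of_norm
  have h1 := (hsum.hasSum.mul_left ((z.im : ℂ) ^ s)).prod_fiberwise fun c =>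
    (hsum.prod_factor c).hasSum.mul_left ((z.im : ℂ) ^ s)
  have h2 := hrow'.unique h1
  rw [h2]
  -- Absolute summability over `(c, m)` permits grouping by `m` instead of by `c`.
  have hsum' := hsum.prod_symm
  have h3 := (hsum.hasSum.mul_left ((z.im : ℂ) ^ s))
  rw [← (Equiv.prodComm ℤ ℕ).hasSum_iff] at h3
  refine h3.prod_fiberwise fun m => ?_
  have h4 := (hsum'.prod_factor m).hasSum.mul_left ((z.im : ℂ) ^ s)
  rw [← tsum_mul_right]
  exact h4

theorem tsum_coeffTerm {N : ℕ} (hN : Squarefree N) {s : ℂ} (hs : 1 < s.re) {m : ℤ} (hm : m ≠ 0) :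
    ∑' c, coeffTerm N s m c =
      sigmaC (1 - 2 * s) m.natAbs / riemannZeta (2 * s) * bigD N m.natAbs s := by
  have h := tsum_gcd_mul_ramanujanSum hN (Int.natAbs_ne_zero.2 hm) (s := s) (by linarith)
  have hNC : (N : ℂ) ≠ 0 := Nat.cast_ne_zero.2 hN.ne_zero
  have h1 (c : ℕ) : coeffTerm N s m c = (N : ℂ) ^ (-s) *
      (((c.gcd N : ℕ) : ℂ) ^ s * (ramanujanSum m.natAbs c / (c : ℂ) ^ (2 * s))) := by
    rw [coeffTerm]
    ring
  simp_rw [h1]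
  rw [tsum_mul_left, h, ← mul_assoc, ← Complex.cpow_add _ _ hNC, neg_add_cancel,
    Complex.cpow_zero, one_mul]

/-! ### Comparison with Whittaker functions -/

theorem whittaker_eq_besselInt (s : ℂ) {m : ℤ} (hm : m ≠ 0) (z : ℍ) :
    whittaker s m z = (Real.sqrt (|(m : ℝ)| * z.im) : ℂ) *
      ((Real.pi * (|(m : ℝ)| * z.im) : ℝ) : ℂ) ^ (1 / 2 - s) *
      besselInt (s - 1 / 2) ((Real.pi * m * z.im) ^ 2) *
      Complex.exp (2 * Real.pi * Complex.I * m * z.re) := by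
  have hm' : 0 < |(m : ℝ)| := abs_pos.2 (Int.cast_ne_zero.2 hm)
  have hy := z.im_pos
  have hpi := Real.pi_pos
  have hx : 0 < 2 * Real.pi * |(m : ℝ)| * z.im := by positivity
  have h1 : (2 * Real.pi * |(m : ℝ)| * z.im) ^ 2 / 4 = (Real.pi * m * z.im) ^ 2 := by
    linear_combination (Real.pi * z.im) ^ 2 * sq_abs (m : ℝ)
  have h2 : ((2 / (2 * Real.pi * |(m : ℝ)| * z.im) : ℝ) : ℂ) ^ (s - 1 / 2) =
      ((Real.pi * (|(m : ℝ)| * z.im) : ℝ) : ℂ) ^ (1 / 2 - s) := by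
    have h3 : 2 / (2 * Real.pi * |(m : ℝ)| * z.im) = (Real.pi * (|(m : ℝ)| * z.im))⁻¹ := by
      field_simp
    rw [h3, Complex.ofReal_inv, Complex.inv_cpow, ← Complex.cpow_neg, neg_sub]
    rw [Complex.arg_ofReal_of_nonneg (by positivity)]
    exact hpi.ne
  rw [whittaker, besselK_eq_besselInt _ hx, h1, h2]
  ring

theorem cpow_mul_rowMode (s : ℂ) {m : ℤ} (hm : m ≠ 0) (z : ℍ) :
    (z.im : ℂ) ^ s * rowMode s z m =
      (Real.pi : ℂ) ^ s * ((m.natAbs : ℂ) ^ (s - 1) / Complex.Gamma s) * whittaker s m z := by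
  have hm' : 0 < |(m : ℝ)| := abs_pos.2 (Int.cast_ne_zero.2 hm)
  have hy := z.im_pos
  have hpi := Real.pi_pos
  have hmC : ((|(m : ℝ)| : ℝ) : ℂ) ≠ 0 := Complex.ofReal_ne_zero.2 hm'.ne'
  have hyC : ((z.im : ℝ) : ℂ) ≠ 0 := Complex.ofReal_ne_zero.2 hy.ne'
  have hpiC : (Real.pi : ℂ) ≠ 0 := Complex.ofReal_ne_zero.2 hpi.ne'
  have hnat : (m.natAbs : ℂ) = ((|(m : ℝ)| : ℝ) : ℂ) := by
    rw [Nat.cast_natAbs, ← Int.cast_abs, Complex.ofReal_intCast]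
  have hsqrt {x : ℝ} (hx : 0 ≤ x) : ((Real.sqrt x : ℝ) : ℂ) = (x : ℂ) ^ (1 / 2 : ℂ) := by
    rw [Real.sqrt_eq_rpow, Complex.ofReal_cpow hx]
    push_cast
    rfl
  have key : (z.im : ℂ) ^ s * ((Real.sqrt Real.pi : ℂ) * (z.im : ℂ) ^ (1 - 2 * s)) =
      (Real.pi : ℂ) ^ s * (m.natAbs : ℂ) ^ (s - 1) * ((Real.sqrt (|(m : ℝ)| * z.im) : ℂ) *
      ((Real.pi * (|(m : ℝ)| * z.im) : ℝ) : ℂ) ^ (1 / 2 - s)) := by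
    rw [hsqrt hpi.le, hsqrt (by positivity), hnat, Complex.ofReal_mul Real.pi,
      Complex.mul_cpow_ofReal_nonneg hpi.le (by positivity), Complex.ofReal_mul |(m : ℝ)|,
      Complex.mul_cpow_ofReal_nonneg hm'.le hy.le, Complex.mul_cpow_ofReal_nonneg hm'.le hy.le]
    -- The powers of `|m|`, `π` and `y` balance separately.
    have hM : ((|(m : ℝ)| : ℝ) : ℂ) ^ (s - 1) * ((|(m : ℝ)| : ℝ) : ℂ) ^ (1 / 2 : ℂ) *
        ((|(m : ℝ)| : ℝ) : ℂ) ^ (1 / 2 - s) = 1 := by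
      rw [← Complex.cpow_add _ _ hmC, ← Complex.cpow_add _ _ hmC]
      ring_nf
      exact Complex.cpow_zero _
    have hP : (Real.pi : ℂ) ^ s * (Real.pi : ℂ) ^ (1 / 2 - s) = (Real.pi : ℂ) ^ (1 / 2 : ℂ) := by
      rw [← Complex.cpow_add _ _ hpiC]
      ring_nf
    have hY : (z.im : ℂ) ^ (1 / 2 : ℂ) * (z.im : ℂ) ^ (1 / 2 - s) =
        (z.im : ℂ) ^ s * (z.im : ℂ) ^ (1 - 2 * s) := by
      rw [← Complex.cpow_add _ _ hyC, ← Complex.cpow_add _ _ hyC]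
      ring_nf
    linear_combination -((Real.pi : ℂ) ^ s * (Real.pi : ℂ) ^ (1 / 2 - s)) *
      ((z.im : ℂ) ^ (1 / 2 : ℂ) * (z.im : ℂ) ^ (1 / 2 - s)) * hM -
      ((z.im : ℂ) ^ (1 / 2 : ℂ) * (z.im : ℂ) ^ (1 / 2 - s)) * hP -
      (Real.pi : ℂ) ^ (1 / 2 : ℂ) * hY
  rw [whittaker_eq_besselInt s hm, rowMode]
  linear_combination (besselInt (s - 1 / 2) ((Real.pi * m * z.im) ^ 2) *
    Complex.exp (2 * Real.pi * Complex.I * m * z.re) / Complex.Gamma s) * key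

theorem hasSum_ne_zero_iff {f : ℤ → ℂ} {a : ℂ} :
    HasSum (fun m : {m : ℤ // m ≠ 0} => f m) (a - f 0) ↔ HasSum f a := by
  have h : (fun m : ℤ => f m - if m = 0 then f 0 else 0) = ({m : ℤ | m ≠ 0}).indicator f := by
    funext m
    by_cases hm : m = 0 <;> simp [hm]
  rw [show HasSum (fun m : {m : ℤ // m ≠ 0} => f m) (a - f 0) ↔
    HasSum (({m : ℤ | m ≠ 0}).indicator f) (a - f 0) from hasSum_subtype_iff_indicator, ← h]
  refine ⟨fun h => ?_, fun h => h.sub (hasSum_ite_eq 0 (f 0))⟩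
  simpa using h.add (hasSum_ite_eq 0 (f 0))

theorem hasFourierExpansion_closedForm {N : ℕ} (hN : Squarefree N) {s : ℂ} (hs : 1 < s.re) :
    HasFourierExpansion N s
      ((∑' c, coeffTerm N s 0 c) * ((Real.sqrt Real.pi : ℂ) / Complex.Gamma s *
        Complex.Gamma (s - 1 / 2)))
      (fun m => closedForm N (m : ℤ).natAbs s) := by
  intro z
  have h := hasSum_ne_zero_iff.2 (hasSum_eisenstein hN hs z)
  have hyC : ((z.im : ℝ) : ℂ) ≠ 0 := Complex.ofReal_ne_zero.2 z.im_pos.ne'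
  -- At `m = 0` the Bessel integral is `Γ(s - 1/2)`, so this mode is the `y^{1-s}` term.
  have h2 : rowMode s z 0 = (Real.sqrt Real.pi : ℂ) / Complex.Gamma s *
      (z.im : ℂ) ^ (1 - 2 * s) * Complex.Gamma (s - 1 / 2) := by
    have : 0 < (s - 1 / 2).re := by
      norm_num
      linarith
    rw [← besselInt_zero this]
    simp [rowMode]
  have h3 : (z.im : ℂ) ^ (1 - s) = (z.im : ℂ) ^ s * (z.im : ℂ) ^ (1 - 2 * s) := by
    rw [← Complex.cpow_add _ _ hyC]
    ring_nf
  have h4 : eisenstein N z s - ((z.im : ℂ) ^ s + (∑' c, coeffTerm N s 0 c) *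
      ((Real.sqrt Real.pi : ℂ) / Complex.Gamma s * Complex.Gamma (s - 1 / 2)) *
        (z.im : ℂ) ^ (1 - s)) =
      eisenstein N z s - (z.im : ℂ) ^ s -
        (z.im : ℂ) ^ s * ((∑' c, coeffTerm N s 0 c) * rowMode s z 0) := by
    rw [h2, h3]
    ring
  rw [h4]
  refine h.congr_fun fun m => ?_
  have h1 := cpow_mul_rowMode s m.2 z
  rw [tsum_coeffTerm hN hs m.2]
  simp only [closedForm]
  linear_combination -(sigmaC (1 - 2 * s) (m : ℤ).natAbs / riemannZeta (2 * s) *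
    bigD N (m : ℤ).natAbs s) * h1

/-! ### Uniqueness of the Fourier coefficients -/

theorem integral_exp_two_pi_int (n : ℤ) :
    ∫ x in (0 : ℝ)..1, Complex.exp (2 * Real.pi * Complex.I * n * x) = if n = 0 then 1 else 0 := by
  split_ifs with hn
  · simp [hn]
  · have hc : (2 * Real.pi * Complex.I * n : ℂ) ≠ 0 :=
      mul_ne_zero Complex.two_pi_I_ne_zero (Int.cast_ne_zero.2 hn)
    rw [integral_exp_mul_complex hc]
    have : Complex.exp (2 * Real.pi * Complex.I * n) = 1 := by
      rw [mul_comm]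
      exact Complex.exp_int_mul_two_pi_mul_I n
    simp [this]

/-- A pointwise convergent Fourier series with sum zero has zero coefficients. -/
theorem eq_zero_of_hasSum_fourier {u : ℤ → ℂ}
    (h : ∀ x : ℝ, HasSum (fun m : ℤ => u m * Complex.exp (2 * Real.pi * Complex.I * m * x)) 0)
    (n : ℤ) : u n = 0 := by
  -- Convergence at `x = 0` is already absolute convergence of the coefficients, which justifies
  -- integrating termwise.
  have hu : Summable fun m => ‖u m‖ := by simpa using (h 0).summable.norm
  have h1 (x : ℝ) : HasSum (fun m : ℤ =>
      u m * Complex.exp (2 * Real.pi * Complex.I * (m - n : ℤ) * x)) 0 := by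
    have := (h x).mul_right (Complex.exp (-(2 * Real.pi * Complex.I * n * x)))
    rw [zero_mul] at this
    refine this.congr_fun fun m => ?_
    rw [mul_assoc (u m), ← Complex.exp_add]
    congr 2
    push_cast
    ring
  have h2 := intervalIntegral.hasSum_integral_of_dominated_convergence (a := 0) (b := 1)
    (μ := volume) (F := fun (m : ℤ) (x : ℝ) =>
      u m * Complex.exp (2 * Real.pi * Complex.I * (m - n : ℤ) * x)) (f := fun _ => 0)
    (fun m _ => ‖u m‖) (fun m => Continuous.aestronglyMeasurable (by fun_prop))
    (fun m => .of_forall fun x _ => by rw [norm_mul, norm_exp_two_pi_int, mul_one])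
    (.of_forall fun _ _ => hu) (by simp) (.of_forall fun x _ => h1 x)
  simp only [intervalIntegral.integral_const_mul, integral_exp_two_pi_int, sub_eq_zero] at h2
  have h3 := hasSum_ite_eq n (u n)
  have h4 := h2.unique (h3.congr_fun fun m => by
    by_cases hm : m = n <;> simp [hm])
  simpa using h4.symm

theorem exists_besselInt_ne_zero {ν : ℂ} (hν : 0 < ν.re) {m : ℤ} (hm : m ≠ 0) :
    ∃ y : ℝ, 0 < y ∧ besselInt ν ((Real.pi * m * y) ^ 2) ≠ 0 := by
  have h1 : ∀ᶠ a in 𝓝[>] (0 : ℝ), besselInt ν a ≠ 0 :=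
    (tendsto_besselInt hν).eventually_ne (Complex.Gamma_ne_zero_of_re_pos hν)
  obtain ⟨a, ha, ha0⟩ := (h1.and self_mem_nhdsWithin).exists
  have ha0 : 0 < a := ha0
  have hm' : 0 < |(m : ℝ)| := abs_pos.2 (Int.cast_ne_zero.2 hm)
  have hpi := Real.pi_pos
  refine ⟨Real.sqrt a / (Real.pi * |(m : ℝ)|), by positivity, ?_⟩
  have : (Real.pi * m * (Real.sqrt a / (Real.pi * |(m : ℝ)|))) ^ 2 = a := by
    have hmR : (m : ℝ) ≠ 0 := Int.cast_ne_zero.2 hm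
    rw [mul_pow, div_pow, mul_pow, mul_pow, sq_abs, Real.sq_sqrt ha0.le]
    field_simp
  rwa [this]

/-- The Fourier coefficients of the Eisenstein series are uniquely determined. -/
theorem HasFourierExpansion.coeff_unique {N : ℕ} {s : ℂ} (hs : 1 / 2 < s.re) {c₀ c₀' : ℂ}
    {c c' : {m : ℤ // m ≠ 0} → ℂ} (h : HasFourierExpansion N s c₀ c)
    (h' : HasFourierExpansion N s c₀' c') : c = c' := by
  funext n
  have hν : 0 < (s - 1 / 2).re := by
    norm_num
    linarith
  obtain ⟨y, hy, hne⟩ := exists_besselInt_ne_zero hν n.2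
  set w : ℤ → ℂ := fun m => (Real.sqrt (|(m : ℝ)| * y) : ℂ) *
      ((Real.pi * (|(m : ℝ)| * y) : ℝ) : ℂ) ^ (1 / 2 - s) *
      besselInt (s - 1 / 2) ((Real.pi * m * y) ^ 2) with hw
  set k : ℂ := (c₀' - c₀) * (y : ℂ) ^ (1 - s) with hk
  -- The two expansions may have different constant terms; the zero mode `-k` absorbs the difference
  -- at the fixed height `y`.
  set u : ℤ → ℂ := fun m => if hm : m ≠ 0 then (c ⟨m, hm⟩ - c' ⟨m, hm⟩) * w m else -k with hu
  have hsum (x : ℝ) :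
      HasSum (fun m : ℤ => u m * Complex.exp (2 * Real.pi * Complex.I * m * x)) 0 := by
    have h1 := (h ⟨⟨x, y⟩, hy⟩).sub (h' ⟨⟨x, y⟩, hy⟩)
    have h2 : (0 : ℂ) - u 0 * Complex.exp (2 * Real.pi * Complex.I * (0 : ℤ) * x) =
        (eisenstein N ⟨⟨x, y⟩, hy⟩ s - ((y : ℂ) ^ s + c₀ * (y : ℂ) ^ (1 - s))) -
        (eisenstein N ⟨⟨x, y⟩, hy⟩ s - ((y : ℂ) ^ s + c₀' * (y : ℂ) ^ (1 - s))) := by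
      simp [hu, hk]
      ring
    refine hasSum_ne_zero_iff.1 ?_
    rw [h2]
    refine h1.congr_fun fun m => ?_
    rw [whittaker_eq_besselInt s m.2, ← sub_mul]
    simp only [hu, hw, dif_pos m.2]
    exact mul_assoc _ _ _
  have h0 := eq_zero_of_hasSum_fourier hsum n
  simp only [hu, dif_pos n.2] at h0
  have hm' : 0 < |((n : ℤ) : ℝ)| := abs_pos.2 (Int.cast_ne_zero.2 n.2)
  have hpi := Real.pi_pos
  have hwne : w n ≠ 0 := by
    refine mul_ne_zero (mul_ne_zero ?_ ?_) hne
    · exact Complex.ofReal_ne_zero.2 (by positivity)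
    · rw [Ne, Complex.cpow_eq_zero_iff]
      rintro ⟨h, -⟩
      exact (by positivity : Real.pi * (|((n : ℤ) : ℝ)| * y) ≠ 0) (Complex.ofReal_eq_zero.1 h)
  exact sub_eq_zero.1 ((mul_eq_zero.1 h0).resolve_right hwne)

end Moonshine

theorem theorem4p2 (N : ℕ) (hN : Squarefree N) :
    (∀ s : ℂ, 1 < s.re →
      -- the Eisenstein series converges absolutely and has a Fourier expansion
      (∀ z : UpperHalfPlane, Summable fun q => (Moonshine.cosetIm N z q : ℂ) ^ s) ∧
      (∃ (c₀ : ℂ) (c : {m : ℤ // m ≠ 0} → ℂ), Moonshine.HasFourierExpansion N s c₀ c) ∧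
      -- whose coefficients are given by the closed form
      ∀ (c₀ : ℂ) (c : {m : ℤ // m ≠ 0} → ℂ), Moonshine.HasFourierExpansion N s c₀ c →
        ∀ (m : ℕ) (hm : m ≠ 0),
          c ⟨(m : ℤ), Nat.cast_ne_zero.2 hm⟩ = Moonshine.closedForm N m s ∧
          c ⟨-(m : ℤ), neg_ne_zero.2 (Nat.cast_ne_zero.2 hm)⟩ = Moonshine.closedForm N m s) ∧
    ∀ m : ℕ, m ≠ 0 →
      -- the closed form is meromorphic on the whole plane
      MeromorphicOn (Moonshine.closedForm N m) Set.univ ∧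
      -- and its last factor is a finite product of local factors
      ∀ s : ℂ, Moonshine.bigD N m s =
        ∏ p ∈ N.primeFactors,
          (1 - (1 - 1 / (p : ℂ) ^ s) * (Moonshine.localF p m (2 * s))⁻¹) := by
  refine ⟨fun s hs => ⟨Moonshine.summable_eisenstein hN hs,
    ⟨_, _, Moonshine.hasFourierExpansion_closedForm hN hs⟩, fun c₀ c h m hm => ?_⟩,
    fun m hm => ⟨Moonshine.meromorphicOn_closedForm hN hm, Moonshine.bigD_eq_prod hN m⟩⟩
  rw [h.coeff_unique (by linarith) (Moonshine.hasFourierExpansion_closedForm hN hs)]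
  simp
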